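/- Let $\mathbb{D}$ be the open unit disc of $\mathbb{C}$ and $dA=\frac{dx\,dy}{\pi}$ the normalized area measure on it. Let $\omega\in L^1([0,1))$ be nonnegative with $\widehat{\omega}(r)=\int_r^1\omega(s)\,ds>0$ for all $0\le r<1$, extend it to $\mathbb{D}$ by $\omega(z)=\omega(|z|)$, and suppose that $\omega\in\widehat{\mathcal D}$, that is, there is a constant $C\ge 1$ such that $\widehat{\omega}(r)\le C\,\widehat{\omega}\left(\frac{1+r}{2}\right)$ for all $0\le r<1$. For $z\in\mathbb{D}$ let $B^\omega_z$ be the reproducing kernel at $z$ of the Bergman space $A^2_\omega$ of analytic functions $f$ on $\mathbb{D}$ with $\int_{\mathbb{D}}|f|^2\omega\,dA<\infty$, so that $B^\omega_z\in A^2_\omega$ and $f(z)=\int_{\mathbb{D}}f(\zeta)\overline{B^\omega_z(\zeta)}\,\omega(\zeta)\,dA(\zeta)$ for all $f\in A^2_\omega$. Let $$H_\omega(f)(z)=\int_0^1 f(t)\left(\frac1z\int_0^z B^\omega_t(u)\,du\right)\omega(t)\,dt,\qquad z\in\mathbb{D}$$ (the inner mean being $B^\omega_t(0)$ at $z=0$).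 Let $H^1$ be the Hardy space of analytic functions $f$ on $\mathbb{D}$ with $\|f\|_{H^1}=\sup_{0<r<1}\frac{1}{2\pi}\int_0^{2\pi}|f(re^{i\theta})|\,d\theta<\infty$. Then the following statements are equivalent: (i) $H_\omega:H^1\to H^1$ is bounded; that is, there is a constant $C<\infty$ such that for every $f\in H^1$ the integral defining $H_\omega(f)(z)$ converges absolutely for every $z\in\mathbb{D}$, $H_\omega(f)\in H^1$, and $\|H_\omega(f)\|_{H^1}\le C\|f\|_{H^1}$; (ii) the measure $d\mu_\omega(t)=\omega(t)\left(1+\int_0^t\frac{ds}{\widehat{\omega}(s)}\right)dt$ on the radius $[0,1)$, regarded as a Borel measure on $\mathbb{D}$, is a $1$-Carleson measure for $H^1$; that is, $H^1\subset L^1(\mu_\omega)$ and the identity map $H^1\to L^1(\mu_\omega)$ is bounded; (iii) $$\sup_{a\in[0,1)}\frac{1}{1-a}\int_a^1\omega(t)\left(1+\int_0^t\frac{ds}{\widehat{\omega}(s)}\right)dt<\infty.$$ -/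

import Mathlib

open MeasureTheory Set
open scoped ENNReal NNReal ComplexConjugate

noncomputable section

namespace HilbertType

/-- The open unit disc of the complex plane. -/
def disc : Set ℂ := Metric.ball 0 1

/-- The normalized area measure `dA = dx dy / π` on the unit disc. -/
def areaMeasure : Measure ℂ := ENNReal.ofReal (Real.pi⁻¹) • volume.restrict disc

/-- The tail integral `r ↦ ∫_r^1 ω(s) ds`. -/
def tail (ω : ℝ → ℝ) (r : ℝ) : ℝ := ∫ s in r..1, ω s

/-- `ω` is (the radial profile of) a radial weight: nonnegative and integrable on `[0,1)`, with
the standing assumption that its tail integrals do not vanish. Its extension to the disc is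
`z ↦ ω ‖z‖`. Values of `ω` outside `[0,1)` are irrelevant. -/
structure IsRadialWeight (ω : ℝ → ℝ) : Prop where
  nonneg : ∀ r ∈ Ico (0 : ℝ) 1, 0 ≤ ω r
  integrable : IntegrableOn ω (Ico 0 1) volume
  tail_pos : ∀ r ∈ Ico (0 : ℝ) 1, 0 < tail ω r

/-- The class of upper doubling radial weights. -/
structure IsUpperDoubling (ω : ℝ → ℝ) : Prop where
  radialWeight : IsRadialWeight ω
  doubling : ∃ C : ℝ, 1 ≤ C ∧ ∀ r ∈ Ico (0 : ℝ) 1, tail ω r ≤ C * tail ω ((1 + r) / 2)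

/-- Membership in the weighted Bergman space `A²_ω`. -/
structure MemBergman2 (ω : ℝ → ℝ) (f : ℂ → ℂ) : Prop where
  analytic : DifferentiableOn ℂ f disc
  integrable : Integrable (fun ζ : ℂ => ‖f ζ‖ ^ 2 * ω ‖ζ‖) areaMeasure

/-- `g` is the reproducing kernel of `A²_ω` at the point `z`: it lies in `A²_ω` and
`f(z) = ⟨f, g⟩` in `A²_ω` for every `f ∈ A²_ω`. Such a `g` is unique as a function on the disc. -/
def IsReproducingKernelAt (ω : ℝ → ℝ) (z : ℂ) (g : ℂ → ℂ) : Prop :=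
  MemBergman2 ω g ∧
    ∀ f : ℂ → ℂ, MemBergman2 ω f →
      f z = ∫ ζ, f ζ * conj (g ζ) * (ω ‖ζ‖ : ℂ) ∂areaMeasure

open Classical in
/-- The Bergman reproducing kernel `B^ω_z` of `A²_ω`, as a function on the disc. (For a radial
weight and `z` in the disc it exists, and its values on the disc are determined.) -/
def bergmanKernel (ω : ℝ → ℝ) (z : ℂ) : ℂ → ℂ :=
  if h : ∃ g : ℂ → ℂ, IsReproducingKernelAt ω z g then h.choose else 0

/-- The averaged kernel `K^ω_t(z) = (1/z) ∫_0^z B^ω_t(u) du`; the integral is along the segment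
`u = s z`, `0 ≤ s ≤ 1`, and the removable singularity at `z = 0` is filled with `B^ω_t(0)`. -/
def averagedKernel (ω : ℝ → ℝ) (t : ℝ) (z : ℂ) : ℂ :=
  if z = 0 then bergmanKernel ω (t : ℂ) 0
  else (1 / z) * ∫ s in (0 : ℝ)..1, bergmanKernel ω (t : ℂ) ((s : ℂ) * z) * z

/-- The integrand, in `t ∈ [0,1)`, of the Hilbert-type operator. -/
def hilbertIntegrand (ω : ℝ → ℝ) (f : ℂ → ℂ) (z : ℂ) (t : ℝ) : ℂ :=
  f (t : ℂ) * averagedKernel ω t z * (ω t : ℂ)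

/-- The Hilbert-type operator `H_ω(f)(z) = ∫_0^1 f(t) K^ω_t(z) ω(t) dt`. -/
def hilbertOp (ω : ℝ → ℝ) (f : ℂ → ℂ) (z : ℂ) : ℂ :=
  ∫ t in Ico (0 : ℝ) 1, hilbertIntegrand ω f z t

/-- The `H¹` norm `sup_{0<r<1} (1/2π) ∫_0^{2π} |f(r e^{iθ})| dθ`, with values in `[0,∞]`. -/
def hardyNorm (f : ℂ → ℂ) : ℝ≥0∞ :=
  ⨆ r ∈ Ioo (0 : ℝ) 1, ENNReal.ofReal (Real.circleAverage (fun z : ℂ => ‖f z‖) 0 r)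

/-- Membership in the Hardy space `H¹` of the disc. -/
structure MemHardy (f : ℂ → ℂ) : Prop where
  analytic : DifferentiableOn ℂ f disc
  norm_lt_top : hardyNorm f < ∞

/-- `H_ω : H¹ → H¹` is bounded: for `f ∈ H¹` the integral defining `H_ω(f)(z)` converges absolutely
at every `z` of the disc, `H_ω(f)` belongs to `H¹`, and its norm is at most a constant times that
of `f`. -/
def HilbertBoundedOnHardy (ω : ℝ → ℝ) : Prop :=
  ∃ C : ℝ≥0, ∀ f : ℂ → ℂ, MemHardy f →
    (∀ z ∈ disc, IntegrableOn (hilbertIntegrand ω f z) (Ico 0 1) volume) ∧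
    MemHardy (hilbertOp ω f) ∧
    hardyNorm (hilbertOp ω f) ≤ C * hardyNorm f

/-- `μ` is a `q`-Carleson measure for `H¹`: the identity `H¹ → L^q(μ)` is defined and bounded. -/
def IsCarlesonForHardy (q : ℝ≥0∞) (μ : Measure ℂ) : Prop :=
  ∃ C : ℝ≥0, ∀ f : ℂ → ℂ, MemHardy f →
    MemLp f q μ ∧ eLpNorm f q μ ≤ C * hardyNorm f

/-- The density `ω(t) (1 + ∫_0^t ds / ω̂(s))`, where `ω̂` is the tail integral of `ω`. -/
def carlesonDensity (ω : ℝ → ℝ) (t : ℝ) : ℝ :=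
  ω t * (1 + ∫ s in (0 : ℝ)..t, 1 / tail ω s)

/-- The measure `ω(t) (1 + ∫_0^t ds / ω̂(s)) dt` on the radius `[0,1)`, viewed as a Borel measure
on the disc. -/
def radialMeasure (ω : ℝ → ℝ) : Measure ℂ :=
  Measure.map (fun t : ℝ => (t : ℂ))
    ((volume.restrict (Ico (0 : ℝ) 1)).withDensity
      (fun t => ENNReal.ofReal (carlesonDensity ω t)))

end HilbertType

end

noncomputable section

namespace HilbertType

open Real (circleAverage)
open Filter Topology

/-! ### Power series on circles -/

/-! Write `W = tailWeight ω`, so that `μ_ω` has density `ω W`. Statements (i) and (ii) are each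
compared with (iii), which is restated as `TailBound`: the mass of `[a,1)` is at most a constant
times `1 - a`.

(ii) ⇔ (iii) is the Carleson theorem on a radius and uses nothing about `ω`. A tail bound for `ν`
bounds its moments by `A/(k+1)`, so Hilbert's inequality embeds `H²` in `L²(ν)`. A polynomial is
dominated by a zero-free majorant `h²` with the same modulus on the circle, and dilations with
Fatou's lemma extend the resulting `L¹` bound to `H¹` (`setLIntegral_enorm_le_hardyNorm`).
Conversely one tests on `(1 - a)/(1 - a z)²`.

For (i), the kernel is explicit: `B_t(z) = ∑ (t z)^n / (2 ω_{2n+1})` with `ω_m` the moments of `ω`,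
and averaging divides the `n`-th coefficient by `n + 1`. Doubling makes `ω_m` comparable to the tail
at `1 - 1/(m+1)`.

(iii) ⇒ (i): the mean of the Bergman kernel series over the circle of radius `σ` is at most a
constant times `W(σ)/(1-σ)` (`exists_circleAverage_kernelFun_le`). Since (iii) forces `W · tail ≤ A
(1 - ·)`, this is `O(1 / tail σ)`, and averaging over dilations bounds the means of `K_t` by a
constant times `W(t)`. Minkowski's inequality then bounds the norm of `H_ω f` by a constant times `∫
|f| ω W`, to which the Carleson embedding applies.

(i) ⇒ (iii): for a test function, `H_ω f` is nonnegative on the radius and its integral there is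
bounded by the Fejér–Riesz inequality, which is the Carleson embedding for Lebesgue measure.
Doubling gives `K_t(x) ≥ c / tail(t x)` (`exists_div_tail_le_tsum`), so integrating in `x` first
recovers the factor `W(t)`. -/

lemma circleMap_zero_norm {ρ : ℝ} (hρ : 0 ≤ ρ) (θ : ℝ) : ‖circleMap 0 ρ θ‖ = ρ := by
  simp [abs_of_nonneg hρ]

/-- Termwise integration of a power series against a continuous function on a circle. -/
lemma hasSum_circleAverage_mul {a : ℕ → ℂ} {ρ : ℝ} (hρ : 0 ≤ ρ)
    (ha : Summable fun n => ‖a n‖ * ρ ^ n) {F g : ℂ → ℂ}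
    (hF : ∀ z, ‖z‖ = ρ → HasSum (fun n => a n * z ^ n) (F z))
    (hg : ContinuousOn g (Metric.sphere 0 ρ)) :
    HasSum (fun n => a n * circleAverage (fun z => z ^ n * g z) 0 ρ)
      (circleAverage (fun z => F z * g z) 0 ρ) := by
  obtain ⟨M, hM⟩ := (isCompact_sphere (0 : ℂ) ρ).exists_bound_of_continuousOn hg
  have hmem (θ : ℝ) : circleMap 0 ρ θ ∈ Metric.sphere (0 : ℂ) ρ := circleMap_mem_sphere 0 hρ θ
  have hgc : Continuous fun θ => g (circleMap 0 ρ θ) :=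
    hg.comp_continuous (continuous_circleMap 0 ρ) hmem
  have key : HasSum
      (fun n => ∫ θ in (0 : ℝ)..2 * Real.pi, a n * (circleMap 0 ρ θ ^ n * g (circleMap 0 ρ θ)))
      (∫ θ in (0 : ℝ)..2 * Real.pi, F (circleMap 0 ρ θ) * g (circleMap 0 ρ θ)) := by
    refine intervalIntegral.hasSum_integral_of_dominated_convergence
      (fun n _ => ‖a n‖ * ρ ^ n * M) ?_ ?_ ?_ ?_ ?_
    · intro n
      exact (continuous_const.mul (((continuous_circleMap 0 ρ).pow n).mul hgc)).aestronglyMeasurable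
    · refine fun n => Filter.Eventually.of_forall fun θ _ => ?_
      rw [norm_mul, norm_mul, norm_pow, circleMap_zero_norm hρ, mul_assoc]
      gcongr
      exact hM _ (hmem θ)
    · exact Filter.Eventually.of_forall fun θ _ => ha.mul_right M
    · exact intervalIntegrable_const
    · refine Filter.Eventually.of_forall fun θ _ => ?_
      simpa [mul_assoc] using (hF _ (circleMap_zero_norm hρ θ)).mul_right (g (circleMap 0 ρ θ))
  have h2 := key.const_smul ((2 * Real.pi)⁻¹ : ℝ)
  simp only [intervalIntegral.integral_const_mul] at h2
  simpa only [Real.circleAverage_def, mul_smul_comm] using h2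

lemma circleAverage_pow_mul_conj_pow (m n : ℕ) (ρ : ℝ) :
    circleAverage (fun z : ℂ => z ^ m * conj z ^ n) 0 ρ =
      if m = n then (ρ : ℂ) ^ (2 * n) else 0 := by
  have h (θ : ℝ) : circleMap 0 ρ θ ^ m * conj (circleMap 0 ρ θ) ^ n
      = (ρ : ℂ) ^ (m + n) * Complex.exp ((((m : ℤ) - n : ℤ) * Complex.I) * θ) := by
    simp only [circleMap, zero_add, map_mul, Complex.conj_ofReal, ← Complex.exp_conj,
      Complex.conj_I, mul_pow, ← Complex.exp_nat_mul]
    rw [mul_mul_mul_comm, ← pow_add, ← Complex.exp_add]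
    congr 2
    push_cast; ring
  rw [Real.circleAverage_def]
  simp_rw [h]
  rw [intervalIntegral.integral_const_mul]
  split_ifs with hmn
  · subst hmn
    simp [← two_mul]
    field_simp
  · have hne : (((m : ℤ) - n : ℤ) : ℂ) ≠ 0 := by
      rw [Int.cast_ne_zero]; lia
    rw [integral_exp_mul_complex (mul_ne_zero hne Complex.I_ne_zero)]
    have : Complex.exp ((((m : ℤ) - n : ℤ) * Complex.I) * ((2 * Real.pi : ℝ) : ℂ)) = 1 := by
      rw [← Complex.exp_int_mul_two_pi_mul_I ((m : ℤ) - n)]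
      congr 1; push_cast; ring
    rw [this]; simp

/-- The Cauchy coefficient formula on a circle. -/
lemma circleAverage_mul_conj_pow {a : ℕ → ℂ} {ρ : ℝ} (hρ : 0 ≤ ρ)
    (ha : Summable fun n => ‖a n‖ * ρ ^ n) {F : ℂ → ℂ}
    (hF : ∀ z, ‖z‖ = ρ → HasSum (fun n => a n * z ^ n) (F z)) (n : ℕ) :
    circleAverage (fun z => F z * conj z ^ n) 0 ρ = a n * (ρ : ℂ) ^ (2 * n) := by
  have h := hasSum_circleAverage_mul hρ ha hF (g := fun z => conj z ^ n)
    ((Complex.continuous_conj.pow n).continuousOn)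
  refine h.unique ?_
  simp_rw [circleAverage_pow_mul_conj_pow]
  convert hasSum_ite_eq n (a n * (ρ : ℂ) ^ (2 * n)) using 2 with m
  split_ifs with h <;> simp [h]

lemma continuousOn_sphere_of_hasSum {a : ℕ → ℂ} {ρ : ℝ}
    (ha : Summable fun n => ‖a n‖ * ρ ^ n) {F : ℂ → ℂ}
    (hF : ∀ z, ‖z‖ = ρ → HasSum (fun n => a n * z ^ n) (F z)) :
    ContinuousOn F (Metric.sphere 0 ρ) := by
  have : ContinuousOn (fun z => ∑' n, a n * z ^ n) (Metric.sphere (0 : ℂ) ρ) := by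
    refine continuousOn_tsum (fun n => by fun_prop) ha fun n z hz => ?_
    rw [mem_sphere_zero_iff_norm] at hz
    simp [hz]
  exact this.congr fun z hz => ((hF z (mem_sphere_zero_iff_norm.1 hz)).tsum_eq).symm

/-- Parseval's identity for a power series on a circle. -/
lemma hasSum_circleAverage_norm_sq {a : ℕ → ℂ} {ρ : ℝ} (hρ : 0 ≤ ρ)
    (ha : Summable fun n => ‖a n‖ * ρ ^ n) {F : ℂ → ℂ}
    (hF : ∀ z, ‖z‖ = ρ → HasSum (fun n => a n * z ^ n) (F z)) :
    HasSum (fun n => ‖a n‖ ^ 2 * ρ ^ (2 * n)) (circleAverage (fun z => ‖F z‖ ^ 2) 0 ρ) := by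
  have hFc := continuousOn_sphere_of_hasSum ha hF
  have h := hasSum_circleAverage_mul hρ ha hF (g := fun z => conj (F z))
    (Complex.continuous_conj.comp_continuousOn hFc)
  have h1 (n : ℕ) : circleAverage (fun z => z ^ n * conj (F z)) 0 ρ
      = conj (a n) * (ρ : ℂ) ^ (2 * n) := by
    have hc : CircleIntegrable (fun z => F z * conj z ^ n) 0 ρ :=
      (hFc.mul ((Complex.continuous_conj.pow n).continuousOn)).circleIntegrable hρ
    have h2 := Complex.conjCLE.toContinuousLinearMap.circleAverage_comp_comm hc
    rw [circleAverage_mul_conj_pow hρ ha hF n] at h2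
    simpa [Function.comp_def, mul_comm] using h2
  have h3 : circleAverage (fun z => F z * conj (F z)) 0 ρ
      = ((circleAverage (fun z => ‖F z‖ ^ 2) 0 ρ : ℝ) : ℂ) := by
    have hc : CircleIntegrable (fun z => ‖F z‖ ^ 2) 0 ρ := (hFc.norm.pow 2).circleIntegrable hρ
    have h2 := Complex.ofRealCLM.circleAverage_comp_comm hc
    simpa [Function.comp_def, Complex.mul_conj'] using h2
  rw [h3] at h
  rw [← Complex.hasSum_ofReal]
  convert h using 2 with n
  rw [h1, ← mul_assoc, Complex.mul_conj']
  push_cast; ring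

/-- Taylor expansion of a holomorphic function on the unit disc. -/
lemma exists_hasSum_of_differentiableOn {f : ℂ → ℂ} (hf : DifferentiableOn ℂ f disc) :
    ∃ a : ℕ → ℂ, ∀ z ∈ disc, HasSum (fun n => a n * z ^ n) (f z) := by
  refine ⟨fun n => (n.factorial : ℂ)⁻¹ * iteratedDeriv n f 0, fun z hz => ?_⟩
  have := Complex.hasSum_taylorSeries_on_ball (c := 0) (r := 1) (f := f) hf hz
  simpa [mul_assoc, mul_comm, mul_left_comm] using this

lemma summable_norm_of_hasSum_disc {a : ℕ → ℂ} {f : ℂ → ℂ}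
    (h : ∀ z ∈ disc, HasSum (fun n => a n * z ^ n) (f z)) {ρ : ℝ} (h0 : 0 ≤ ρ) (h1 : ρ < 1) :
    Summable fun n => ‖a n‖ * ρ ^ n := by
  have := (h (ρ : ℂ) (by simp [disc, abs_of_nonneg h0, h1])).summable.norm
  simpa [abs_of_nonneg h0] using this

/-! ### Carleson measures on the radius -/

/-- A form of Fatou's lemma. -/
lemma lintegral_enorm_le_of_tendsto {α : Type*} [MeasurableSpace α] {μ : Measure α}
    {F : ℕ → α → ℂ} {f : α → ℂ} {B : ℕ → ℝ≥0∞} {b : ℝ≥0∞}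
    (hm : ∀ N, AEStronglyMeasurable (F N) μ)
    (h : ∀ᵐ t ∂μ, Tendsto (fun N => F N t) atTop (𝓝 (f t)))
    (hB : ∀ N, ∫⁻ t, ‖F N t‖ₑ ∂μ ≤ B N) (hb : Tendsto B atTop (𝓝 b)) :
    ∫⁻ t, ‖f t‖ₑ ∂μ ≤ b := by
  calc ∫⁻ t, ‖f t‖ₑ ∂μ = ∫⁻ t, liminf (fun N => ‖F N t‖ₑ) atTop ∂μ := by
        refine lintegral_congr_ae ?_
        filter_upwards [h] with t ht
        exact (ht.enorm.liminf_eq).symm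
    _ ≤ liminf (fun N => ∫⁻ t, ‖F N t‖ₑ ∂μ) atTop := lintegral_liminf_le' fun N => (hm N).enorm
    _ ≤ liminf B atTop := liminf_le_liminf (Eventually.of_forall hB)
    _ = b := hb.liminf_eq

/-- Layer-cake formula: for positive exponents the moment is the integral of `ν([s,1))` against the
derivative of the power, and the remaining Beta integral is `∫_0^1 (1-s)(k+1)s^k ds = 1/(k+2)`.
Exponent zero is the total mass. -/
lemma setLIntegral_pow_le {ν : Measure ℝ} {A : ℝ≥0}
    (hν : ∀ a ∈ Ico (0 : ℝ) 1, ν (Ico a 1) ≤ A * ENNReal.ofReal (1 - a)) (k : ℕ) :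
    ∫⁻ t in Ico (0 : ℝ) 1, ENNReal.ofReal (t ^ k) ∂ν ≤ A * ENNReal.ofReal (1 / (k + 1)) := by
  rcases k with _ | k
  · simpa using hν 0 (by simp)
  have h1 := lintegral_comp_eq_lintegral_meas_le_mul (ν.restrict (Ico (0 : ℝ) 1)) (f := fun t => t)
    (g := fun s => (k + 1) * s ^ k)
    ((ae_restrict_iff' measurableSet_Ico).2 (Eventually.of_forall fun t ht => ht.1))
    aemeasurable_id' (fun t _ => (by fun_prop : Continuous _).intervalIntegrable _ _)
    ((ae_restrict_iff' measurableSet_Ioi).2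
      (Eventually.of_forall fun t (ht : 0 < t) => by positivity))
  have h2 (t : ℝ) : ∫ s in (0 : ℝ)..t, ((k : ℝ) + 1) * s ^ k = t ^ (k + 1) := by
    rw [intervalIntegral.integral_const_mul, integral_pow]
    field_simp
    simp
  simp_rw [h2] at h1
  rw [h1]
  have h3 : ∀ s ∈ Ioi (0 : ℝ), ν.restrict (Ico (0 : ℝ) 1) {a | s ≤ a} *
      ENNReal.ofReal ((k + 1) * s ^ k) ≤
      A * (Ioc (0 : ℝ) 1).indicator
        (fun s => ENNReal.ofReal ((1 - s) * ((k + 1) * s ^ k))) s := by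
    intro s (hs : 0 < s)
    have he : {a | s ≤ a} ∩ Ico (0 : ℝ) 1 = Ico s 1 := by
      ext a; simp only [mem_inter_iff, mem_ofPred_eq, mem_Ico]; constructor
      · rintro ⟨h, -, h'⟩; exact ⟨h, h'⟩
      · rintro ⟨h, h'⟩; exact ⟨h, by linarith, h'⟩
    rw [Measure.restrict_apply (measurableSet_le measurable_const measurable_id'), he]
    by_cases hs1 : s < 1
    · rw [indicator_of_mem (by exact ⟨hs, hs1.le⟩), ENNReal.ofReal_mul (p := 1 - s) (by linarith),
        ← mul_assoc]
      gcongr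
      exact hν s ⟨hs.le, hs1⟩
    · simp [Ico_eq_empty hs1]
  refine (setLIntegral_mono' measurableSet_Ioi h3).trans ?_
  rw [lintegral_const_mul' _ _ ENNReal.coe_ne_top, lintegral_indicator measurableSet_Ioc,
    Measure.restrict_restrict measurableSet_Ioc, inter_eq_self_of_subset_left Ioc_subset_Ioi_self]
  gcongr
  have hc : Continuous fun s : ℝ => (1 - s) * (((k : ℝ) + 1) * s ^ k) := by fun_prop
  rw [← ofReal_integral_eq_lintegral_ofReal hc.integrableOn_Ioc
    ((ae_restrict_iff' measurableSet_Ioc).2 (Eventually.of_forall fun s hs =>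
      mul_nonneg (by linarith [hs.2]) (by have := hs.1; positivity))),
    ← intervalIntegral.integral_of_le zero_le_one]
  refine ENNReal.ofReal_le_ofReal (le_of_eq ?_)
  have : ∀ s : ℝ, (1 - s) * (((k : ℝ) + 1) * s ^ k) = (k + 1) * s ^ k - (k + 1) * s ^ (k + 1) :=
    fun s => by ring
  simp_rw [this]
  rw [intervalIntegral.integral_sub ((by fun_prop : Continuous _).intervalIntegrable _ _)
    ((by fun_prop : Continuous _).intervalIntegrable _ _), intervalIntegral.integral_const_mul,
    intervalIntegral.integral_const_mul, integral_pow, integral_pow]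
  push_cast
  have : (k : ℝ) + 1 ≠ 0 := by positivity
  have : (k : ℝ) + 1 + 1 ≠ 0 := by positivity
  simp
  field_simp
  ring

/-- The row sums for Schur's test on the Hilbert matrix, with weight `1/√(m+1)`. -/
lemma sum_one_div_mul_sqrt_le (n N : ℕ) :
    ∑ m ∈ Finset.range N, 1 / (((n : ℝ) + m + 1) * √(m + 1)) ≤ 8 / √(n + 1) := by
  set c := √((n : ℝ) + 1) with hc
  have hc0 : 0 < c := by positivity
  have hc2 : c ^ 2 = n + 1 := Real.sq_sqrt (by positivity)
  -- The integral analogue is `(2/c) arctan(√N / c)`. The algebraic substitute `√N / (√N + c)` has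
  -- increments that can be computed exactly, and these dominate the summands.
  have key : ∀ N : ℕ, ∑ m ∈ Finset.range N, 1 / (((n : ℝ) + m + 1) * √(m + 1)) ≤
      8 / c * (√N / (√N + c)) := by
    intro N
    induction N with
    | zero => simp
    | succ m ih =>
      rw [Finset.sum_range_succ]
      refine (add_le_add_left ih _).trans ?_
      push_cast
      set p := √(m : ℝ) with hp
      set q := √((m : ℝ) + 1) with hq
      have hp0 : 0 ≤ p := by positivity
      have hq0 : 0 < q := by positivity
      have hp2 : p ^ 2 = m := Real.sq_sqrt (by positivity)
      have hq2 : q ^ 2 = m + 1 := Real.sq_sqrt (by positivity)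
      have hpq : p ≤ q := Real.sqrt_le_sqrt (by linarith)
      have h1 : 8 / c * (q / (q + c)) - 8 / c * (p / (p + c)) =
          8 / ((q + p) * (q + c) * (p + c)) := by
        have : (q - p) * (q + p) = 1 := by nlinarith
        have : q - p = 1 / (q + p) := by field_simp; linarith
        have h2 : 8 / c * (q / (q + c)) - 8 / c * (p / (p + c)) =
          8 * (q - p) / ((q + c) * (p + c)) := by field_simp; ring
        rw [h2, this]; field_simp
      have h3 : 1 / (((n : ℝ) + m + 1) * q) ≤ 8 / ((q + p) * (q + c) * (p + c)) := by
        rw [div_le_div_iff₀ (by positivity) (by positivity)]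
        have h4 : (q + p) * (q + c) * (p + c) ≤ (2 * q) * (q + c) * (q + c) := by gcongr; linarith
        have h5 : (q + c) * (q + c) ≤ 2 * (q ^ 2 + c ^ 2) := by nlinarith [sq_nonneg (q - c)]
        have h6 : q * ((q + c) * (q + c)) ≤ q * (2 * (q ^ 2 + c ^ 2)) := by gcongr
        rw [hq2, hc2] at h6
        have : 0 ≤ q * n := by positivity
        have : 0 ≤ q * m := by positivity
        nlinarith
      linarith
  refine (key N).trans ?_
  have : √(N : ℝ) / (√N + c) ≤ 1 := by
    rw [div_le_one (by positivity)]; linarith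
  calc 8 / c * (√N / (√N + c)) ≤ 8 / c * 1 := by gcongr
    _ = _ := by ring

/-- Hilbert's inequality, with a non-optimal constant. -/
lemma hilbert_inequality (x : ℕ → ℝ) (N : ℕ) :
    ∑ n ∈ Finset.range N, ∑ m ∈ Finset.range N, x n * x m * (1 / ((n + m : ℕ) + 1 : ℝ)) ≤
      8 * ∑ n ∈ Finset.range N, x n ^ 2 := by
  set w : ℕ → ℝ := fun n => √((n : ℝ) + 1) with hw
  have hw0 : ∀ n, 0 < w n := fun n => by simp only [hw]; positivity
  -- Schur's test: `x n * x m` is split with weights `√(w n / w m)` and `√(w m / w n)`, so that the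
  -- arithmetic-geometric mean inequality leaves only row sums.
  set T : ℕ → ℕ → ℝ := fun n m => x n ^ 2 * (w n * (1 / ((n + m + 1) * w m))) with hT
  have h1 : ∀ n m : ℕ, x n * x m * (1 / ((n + m : ℕ) + 1 : ℝ)) ≤ (T n m + T m n) / 2 := by
    intro n m
    have : (T n m + T m n) / 2 - x n * x m * (1 / ((n + m : ℕ) + 1 : ℝ)) =
        (x n * w n - x m * w m) ^ 2 / (2 * w n * w m * (n + m + 1)) := by
      have := (hw0 n).ne'; have := (hw0 m).ne'
      have h3 : (n : ℝ) + m + 1 ≠ 0 := by positivity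
      have h4 : (m : ℝ) + n + 1 = n + m + 1 := by ring
      simp only [hT, h4]
      push_cast
      field_simp
      ring
    have h2 : 0 ≤ (x n * w n - x m * w m) ^ 2 / (2 * w n * w m * (n + m + 1)) := by
      have := hw0 n; have := hw0 m; positivity
    linarith
  have h2 : ∀ n, ∑ m ∈ Finset.range N, T n m ≤ 8 * x n ^ 2 := by
    intro n
    simp only [hT]
    rw [← Finset.mul_sum, ← Finset.mul_sum, mul_comm 8]
    gcongr
    have := mul_le_mul_of_nonneg_left (sum_one_div_mul_sqrt_le n N) (hw0 n).le
    refine this.trans (le_of_eq ?_)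
    have := (hw0 n).ne'
    simp only [hw] at this ⊢
    field_simp
  have h3 : ∑ n ∈ Finset.range N, ∑ m ∈ Finset.range N, T n m ≤
      8 * ∑ n ∈ Finset.range N, x n ^ 2 := by
    rw [Finset.mul_sum]
    exact Finset.sum_le_sum fun n _ => h2 n
  calc _ ≤ ∑ n ∈ Finset.range N, ∑ m ∈ Finset.range N, (T n m + T m n) / 2 :=
        Finset.sum_le_sum fun n _ => Finset.sum_le_sum fun m _ => h1 n m
    _ = ∑ n ∈ Finset.range N, ∑ m ∈ Finset.range N, T n m := by
        simp_rw [add_div, Finset.sum_add_distrib]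
        rw [Finset.sum_comm (f := fun n m => T m n / 2), ← Finset.sum_add_distrib]
        simp_rw [← Finset.sum_add_distrib, add_halves]
    _ ≤ _ := h3

/-- The radial embedding `H² → L²(ν)`. -/
lemma setLIntegral_enorm_sq_le {ν : Measure ℝ} {A : ℝ≥0}
    (hν : ∀ a ∈ Ico (0 : ℝ) 1, ν (Ico a 1) ≤ A * ENNReal.ofReal (1 - a))
    {a : ℕ → ℂ} {h : ℂ → ℂ} (ha : ∀ z ∈ disc, HasSum (fun n => a n * z ^ n) (h z)) {M : ℝ}
    (hM : ∀ N, ∑ n ∈ Finset.range N, ‖a n‖ ^ 2 ≤ M) :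
    ∫⁻ t in Ico (0 : ℝ) 1, ‖h t ^ 2‖ₑ ∂ν ≤ 8 * A * ENNReal.ofReal M := by
  refine lintegral_enorm_le_of_tendsto
    (F := fun N (t : ℝ) => (∑ n ∈ Finset.range N, a n * (t : ℂ) ^ n) ^ 2)
    (B := fun N => 8 * A * ENNReal.ofReal M)
    (fun N => (by fun_prop : Continuous _).aestronglyMeasurable) ?_ ?_ tendsto_const_nhds
  · refine (ae_restrict_iff' measurableSet_Ico).2 (Eventually.of_forall fun t ht => ?_)
    refine ((ha t ?_).tendsto_sum_nat).pow 2
    simp [disc, abs_of_nonneg ht.1, ht.2]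
  intro N
  -- Expanding the square produces the moments of `ν` at `n + m`, and their bound `A / (n + m + 1)`
  -- turns the double sum into the Hilbert form.
  calc ∫⁻ t in Ico (0 : ℝ) 1, ‖(∑ n ∈ Finset.range N, a n * (t : ℂ) ^ n) ^ 2‖ₑ ∂ν
      ≤ ∫⁻ t in Ico (0 : ℝ) 1, ∑ n ∈ Finset.range N, ∑ m ∈ Finset.range N,
          ENNReal.ofReal (‖a n‖ * ‖a m‖) * ENNReal.ofReal (t ^ (n + m)) ∂ν := by
        refine setLIntegral_mono' measurableSet_Ico fun t ht => ?_
        have ht0 := ht.1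
        have : ∑ n ∈ Finset.range N, ∑ m ∈ Finset.range N,
            ENNReal.ofReal (‖a n‖ * ‖a m‖) * ENNReal.ofReal (t ^ (n + m)) =
            ENNReal.ofReal ((∑ n ∈ Finset.range N, ‖a n‖ * t ^ n) ^ 2) := by
          rw [sq, Finset.sum_mul_sum, ENNReal.ofReal_sum_of_nonneg fun n _ => by positivity]
          refine Finset.sum_congr rfl fun n _ => ?_
          rw [ENNReal.ofReal_sum_of_nonneg fun n _ => by positivity]
          refine Finset.sum_congr rfl fun m _ => ?_
          rw [← ENNReal.ofReal_mul (by positivity)]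
          congr 1; ring
        rw [this, ← ofReal_norm, norm_pow]
        gcongr
        refine (norm_sum_le _ _).trans (le_of_eq (Finset.sum_congr rfl fun n _ => ?_))
        simp [abs_of_nonneg ht0]
    _ = ∑ n ∈ Finset.range N, ∑ m ∈ Finset.range N,
          ENNReal.ofReal (‖a n‖ * ‖a m‖) *
            ∫⁻ t in Ico (0 : ℝ) 1, ENNReal.ofReal (t ^ (n + m)) ∂ν := by
        rw [lintegral_finsetSum _ fun n _ => by fun_prop]
        refine Finset.sum_congr rfl fun n _ => ?_
        rw [lintegral_finsetSum _ fun n _ => by fun_prop]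
        refine Finset.sum_congr rfl fun m _ => ?_
        rw [lintegral_const_mul' _ _ ENNReal.ofReal_ne_top]
    _ ≤ ∑ n ∈ Finset.range N, ∑ m ∈ Finset.range N,
          ENNReal.ofReal (‖a n‖ * ‖a m‖) * (A * ENNReal.ofReal (1 / ((n + m : ℕ) + 1))) := by
        gcongr with n _ m _
        exact setLIntegral_pow_le hν (n + m)
    _ = A * ENNReal.ofReal (∑ n ∈ Finset.range N, ∑ m ∈ Finset.range N,
          ‖a n‖ * ‖a m‖ * (1 / ((n + m : ℕ) + 1 : ℝ))) := by
        rw [ENNReal.ofReal_sum_of_nonneg fun n _ => by positivity, Finset.mul_sum]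
        refine Finset.sum_congr rfl fun n _ => ?_
        rw [ENNReal.ofReal_sum_of_nonneg fun n _ => by positivity, Finset.mul_sum]
        refine Finset.sum_congr rfl fun m _ => ?_
        rw [ENNReal.ofReal_mul (p := ‖a n‖ * ‖a m‖) (by positivity)]
        ring
    _ ≤ A * ENNReal.ofReal (8 * M) := by
        gcongr
        exact (hilbert_inequality (fun n => ‖a n‖) N).trans (by gcongr; exact hM N)
    _ = 8 * A * ENNReal.ofReal M := by
        rw [ENNReal.ofReal_mul (by norm_num)]
        simp; ring

/-! ### Zero-free majorants of polynomials -/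

/-- `g` is an outer majorant of `p`: it has a holomorphic square root `h` in the disc, has the same
modulus as `p` on the unit circle, and a larger modulus inside. -/
structure IsOuterMajorant (p g h : ℂ → ℂ) : Prop where
  continuous : Continuous g
  differentiableOn : DifferentiableOn ℂ h disc
  sq_eq : ∀ z ∈ disc, h z ^ 2 = g z
  norm_eq : ∀ z, ‖z‖ = 1 → ‖g z‖ = ‖p z‖
  norm_le : ∀ z ∈ disc, ‖p z‖ ≤ ‖g z‖

lemma IsOuterMajorant.mul {p g h p' g' h' : ℂ → ℂ} (H : IsOuterMajorant p g h)
    (H' : IsOuterMajorant p' g' h') :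
    IsOuterMajorant (fun z => p z * p' z) (fun z => g z * g' z) (fun z => h z * h' z) where
  continuous := H.continuous.mul H'.continuous
  differentiableOn := H.differentiableOn.mul H'.differentiableOn
  sq_eq z hz := by rw [mul_pow, H.sq_eq z hz, H'.sq_eq z hz]
  norm_eq z hz := by rw [norm_mul, norm_mul, H.norm_eq z hz, H'.norm_eq z hz]
  norm_le z hz := by
    rw [norm_mul, norm_mul]; gcongr
    exacts [H.norm_le z hz, H'.norm_le z hz]

lemma isOuterMajorant_const (c : ℂ) :
    IsOuterMajorant (fun _ => c) (fun _ => c) (fun _ => c ^ ((2 : ℕ) : ℂ)⁻¹) where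
  continuous := continuous_const
  differentiableOn := differentiableOn_const _
  sq_eq _ _ := Complex.cpow_nat_inv_pow c two_ne_zero
  norm_eq _ _ := rfl
  norm_le _ _ := le_rfl

/-- In the disc `1 - u z` has positive real part, so the principal square root is holomorphic there.
-/
lemma isOuterMajorant_one_sub_mul {u : ℂ} (hu : ‖u‖ ≤ 1) :
    IsOuterMajorant (fun z => 1 - u * z) (fun z => 1 - u * z)
      (fun z => (1 - u * z) ^ ((2 : ℕ) : ℂ)⁻¹) where
  continuous := by fun_prop
  differentiableOn := by
    intro z hz
    have hz1 : ‖z‖ < 1 := by simpa [disc] using hz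
    have : 1 - u * z ∈ Complex.slitPlane := by
      left
      have h1 : (u * z).re ≤ ‖u * z‖ := Complex.re_le_norm _
      have h2 : ‖u * z‖ < 1 := by
        rw [norm_mul]
        exact (mul_le_of_le_one_left (norm_nonneg _) hu).trans_lt hz1
      simp only [Complex.sub_re, Complex.one_re]
      linarith
    have hd : DifferentiableAt ℂ (fun z => 1 - u * z) z := by fun_prop
    exact (hd.cpow_const this).differentiableWithinAt
  sq_eq z _ := Complex.cpow_nat_inv_pow _ two_ne_zero
  norm_eq _ _ := rfl
  norm_le _ _ := le_rfl

/-- This identity compares the numerator and denominator of a Blaschke factor: equal moduli on the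
circle, and a definite order inside. -/
lemma norm_one_sub_conj_mul_sq_sub (a z : ℂ) :
    ‖1 - conj a * z‖ ^ 2 - ‖z - a‖ ^ 2 = (1 - ‖a‖ ^ 2) * (1 - ‖z‖ ^ 2) := by
  simp only [Complex.sq_norm, Complex.normSq_apply, Complex.sub_re, Complex.sub_im, Complex.mul_re,
    Complex.mul_im, Complex.conj_re, Complex.conj_im, Complex.one_re, Complex.one_im]
  ring

/-- A zero inside the disc is reflected, `z - a` becoming `1 - conj a z`, which amounts to dividing
by a Blaschke factor. A zero outside or on the circle needs no change, because `z - a = -a (1 - a⁻¹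
z)`. -/
lemma exists_isOuterMajorant_sub (a : ℂ) : ∃ g h, IsOuterMajorant (fun z => z - a) g h := by
  rcases lt_or_ge ‖a‖ 1 with ha | ha
  · have H := isOuterMajorant_one_sub_mul (u := conj a) (by simpa using ha.le)
    refine ⟨_, _, H.continuous, H.differentiableOn, H.sq_eq, fun z hz => ?_, fun z hz => ?_⟩
    · have := norm_one_sub_conj_mul_sq_sub a z
      rw [hz] at this
      rw [← sq_eq_sq₀ (norm_nonneg _) (norm_nonneg _)]
      linarith
    · have := norm_one_sub_conj_mul_sq_sub a z
      have hz1 : ‖z‖ < 1 := by simpa [disc] using hz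
      rw [← sq_le_sq₀ (norm_nonneg _) (norm_nonneg _)]
      have : 0 ≤ (1 - ‖a‖ ^ 2) * (1 - ‖z‖ ^ 2) := by
        apply mul_nonneg <;> nlinarith [norm_nonneg a, norm_nonneg z]
      linarith
  · have ha0 : a ≠ 0 := by rintro rfl; simp at ha; linarith
    have H := (isOuterMajorant_const (-a)).mul (isOuterMajorant_one_sub_mul (u := a⁻¹)
      (by rw [norm_inv]; exact inv_le_one_of_one_le₀ ha))
    have : (fun z => -a * (1 - a⁻¹ * z)) = fun z => z - a := by
      ext z; field_simp; ring
    simp only [this] at H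
    exact ⟨_, _, H⟩

lemma exists_isOuterMajorant (p : Polynomial ℂ) :
    ∃ g h, IsOuterMajorant (fun z => p.eval z) g h := by
  have key (s : Multiset ℂ) : ∃ g h, IsOuterMajorant
      (fun z => ((s.map fun a => Polynomial.X - Polynomial.C a).prod).eval z) g h := by
    induction s using Multiset.induction with
    | empty => exact ⟨_, _, by simpa using isOuterMajorant_const 1⟩
    | cons a s ih =>
      obtain ⟨g, h, H⟩ := ih
      obtain ⟨g', h', H'⟩ := exists_isOuterMajorant_sub a
      exact ⟨_, _, by simpa using H'.mul H⟩
  obtain ⟨g, h, H⟩ := key p.roots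
  -- The zero polynomial is included: its leading coefficient is `0`, and constants, zero or not,
  -- are their own majorants.
  have hp := (IsAlgClosed.splits p).eq_prod_roots
  have := (isOuterMajorant_const p.leadingCoeff).mul H
  have he : (fun z => p.eval z) = fun z => p.leadingCoeff *
      ((p.roots.map fun a => Polynomial.X - Polynomial.C a).prod).eval z := by
    ext z
    conv_lhs => rw [hp]
    rw [Polynomial.eval_mul, Polynomial.eval_C]
  rw [he]
  exact ⟨_, _, this⟩

/-- Passage from `H²` to `H¹`: on the radius `|p| ≤ |h|²`, while the `ℓ²` norm of the coefficients
of `h` is controlled by the mean of `|g| = |p|` on the unit circle. -/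
lemma setLIntegral_enorm_polynomial_le {ν : Measure ℝ} {A : ℝ≥0}
    (hν : ∀ a ∈ Ico (0 : ℝ) 1, ν (Ico a 1) ≤ A * ENNReal.ofReal (1 - a)) (p : Polynomial ℂ) :
    ∫⁻ t in Ico (0 : ℝ) 1, ‖p.eval (t : ℂ)‖ₑ ∂ν ≤
      8 * A * ENNReal.ofReal (circleAverage (fun z => ‖p.eval z‖) 0 1) := by
  obtain ⟨g, h, H⟩ := exists_isOuterMajorant p
  obtain ⟨a, ha⟩ := exists_hasSum_of_differentiableOn H.differentiableOn
  have hM (N : ℕ) : ∑ n ∈ Finset.range N, ‖a n‖ ^ 2 ≤ circleAverage (fun z => ‖p.eval z‖) 0 1 := by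
    have h1 : circleAverage (fun z => ‖p.eval z‖) 0 1 = circleAverage (fun z => ‖g z‖) 0 1 := by
      refine Real.circleAverage_congr_sphere fun z hz => ?_
      simp only [abs_one, mem_sphere_zero_iff_norm] at hz
      exact (H.norm_eq z hz).symm
    rw [h1]
    -- Since `h` is only known inside the disc, Parseval is used at radius `ρ < 1`, and `ρ → 1` is
    -- taken for a finite partial sum on one side and for the continuous `g` on the other.
    have hc1 : Continuous fun ρ : ℝ => ∑ n ∈ Finset.range N, ‖a n‖ ^ 2 * ρ ^ (2 * n) := by fun_prop
    have hc2 : Continuous fun ρ : ℝ => circleAverage (fun z => ‖g z‖) 0 ρ := by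
      have := H.continuous
      fun_prop
    have hlim1 := hc1.continuousWithinAt (s := Iio 1) (x := 1)
    have hlim2 := hc2.continuousWithinAt (s := Iio 1) (x := 1)
    have := le_of_tendsto_of_tendsto hlim1 hlim2 ?_
    · simpa using this
    filter_upwards [Ioo_mem_nhdsLT (zero_lt_one : (0 : ℝ) < 1)] with ρ hρ
    have hin : ∀ z : ℂ, ‖z‖ = ρ → z ∈ disc := fun z hz => by simp [disc, hz, hρ.2]
    have hP := hasSum_circleAverage_norm_sq hρ.1.le
      (summable_norm_of_hasSum_disc ha hρ.1.le hρ.2) (fun z hz => ha z (hin z hz))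
    have h2 : circleAverage (fun z => ‖h z‖ ^ 2) 0 ρ = circleAverage (fun z => ‖g z‖) 0 ρ := by
      refine Real.circleAverage_congr_sphere fun z hz => ?_
      rw [mem_sphere_zero_iff_norm, abs_of_pos hρ.1] at hz
      simp only [← H.sq_eq z (hin z hz), norm_pow]
    rw [← h2]
    have := hρ.1
    exact sum_le_hasSum _ (fun n _ => by positivity) hP
  refine le_trans ?_ (setLIntegral_enorm_sq_le hν ha hM)
  refine setLIntegral_mono' measurableSet_Ico fun t ht => ?_
  have hin : (t : ℂ) ∈ disc := by simp [disc, abs_of_nonneg ht.1, ht.2]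
  rw [H.sq_eq _ hin, enorm_le_iff_norm_le]
  exact H.norm_le _ hin

/-- The radial Carleson embedding theorem for `H¹`. -/
theorem setLIntegral_enorm_le_hardyNorm {ν : Measure ℝ} {A : ℝ≥0}
    (hν : ∀ a ∈ Ico (0 : ℝ) 1, ν (Ico a 1) ≤ A * ENNReal.ofReal (1 - a)) {f : ℂ → ℂ}
    (hf : DifferentiableOn ℂ f disc) :
    ∫⁻ t in Ico (0 : ℝ) 1, ‖f t‖ₑ ∂ν ≤ 8 * A * hardyNorm f := by
  obtain ⟨a, ha⟩ := exists_hasSum_of_differentiableOn hf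
  -- The Taylor polynomials of the dilate `f(r ·)` converge on the closed disc, with a summable
  -- majorant, so the polynomial case passes to the dilate.
  have key : ∀ r ∈ Ioo (0 : ℝ) 1, ∫⁻ t in Ico (0 : ℝ) 1, ‖f (r * t)‖ₑ ∂ν ≤ 8 * A * hardyNorm f := by
    intro r hr
    have hsum := summable_norm_of_hasSum_disc ha hr.1.le hr.2
    set p : ℕ → Polynomial ℂ := fun N =>
      ∑ n ∈ Finset.range N, Polynomial.C (a n * r ^ n) * Polynomial.X ^ n with hp
    have hpe (N : ℕ) (z : ℂ) : (p N).eval z = ∑ n ∈ Finset.range N, a n * (r * z) ^ n := by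
      simp [hp, Polynomial.eval_finsetSum, mul_pow, mul_assoc]
    have hlim : ∀ z : ℂ, ‖z‖ ≤ 1 → Tendsto (fun N => (p N).eval z) atTop (𝓝 (f (r * z))) := by
      intro z hz
      simp_rw [hpe]
      refine (ha _ ?_).tendsto_sum_nat
      simp only [disc, mem_ball_zero_iff, norm_mul, Complex.norm_real, Real.norm_eq_abs,
        abs_of_pos hr.1]
      exact (mul_le_of_le_one_right hr.1.le hz).trans_lt hr.2
    have hcirc : Tendsto (fun N => circleAverage (fun z => ‖(p N).eval z‖) 0 1) atTop
        (𝓝 (circleAverage (fun z => ‖f z‖) 0 r)) := by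
      rw [Real.circleAverage_def]
      simp_rw [Real.circleAverage_def]
      refine Tendsto.const_smul ?_ _
      refine intervalIntegral.tendsto_integral_filter_of_dominated_convergence
        (fun _ => ∑' n, ‖a n‖ * r ^ n) ?_ ?_ intervalIntegrable_const ?_
      · refine Eventually.of_forall fun N => Continuous.aestronglyMeasurable ?_
        exact ((p N).continuous.comp (continuous_circleMap 0 1)).norm
      · refine Eventually.of_forall fun N => Eventually.of_forall fun θ _ => ?_
        rw [norm_norm, hpe]
        refine (norm_sum_le _ _).trans ?_
        refine le_trans (le_of_eq ?_) (hsum.sum_le_tsum (Finset.range N)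
          fun n _ => by have := hr.1; positivity)
        refine Finset.sum_congr rfl fun n _ => ?_
        simp [abs_of_pos hr.1]
      · refine Eventually.of_forall fun θ _ => ?_
        have h1 := (hlim (circleMap 0 1 θ) (by simp)).norm
        have h2 : (r : ℂ) * circleMap 0 1 θ = circleMap 0 r θ := by simp [circleMap]
        rwa [h2] at h1
    have hB := ENNReal.Tendsto.const_mul (a := 8 * (A : ℝ≥0∞)) (ENNReal.tendsto_ofReal hcirc)
      (Or.inr (by finiteness))
    refine (lintegral_enorm_le_of_tendsto (F := fun N (t : ℝ) => (p N).eval (t : ℂ)) ?_ ?_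
      (fun N => setLIntegral_enorm_polynomial_le hν (p N)) hB).trans ?_
    · exact fun N => ((p N).continuous.comp Complex.continuous_ofReal).aestronglyMeasurable
    · refine (ae_restrict_iff' measurableSet_Ico).2 (Eventually.of_forall fun t ht => hlim t ?_)
      simp [abs_of_nonneg ht.1, ht.2.le]
    · gcongr
      exact le_iSup₂ (f := fun (r : ℝ) (_ : r ∈ Ioo (0 : ℝ) 1) =>
        ENNReal.ofReal (circleAverage (fun z : ℂ => ‖f z‖) 0 r)) r hr
  -- Undo the dilation by Fatou's lemma along radii tending to `1`; the `2` keeps the first radius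
  -- positive.
  set r : ℕ → ℝ := fun N => 1 - 1 / ((N : ℝ) + 2) with hr
  have hr01 (N : ℕ) : r N ∈ Ioo (0 : ℝ) 1 := by
    have h1 : (0 : ℝ) < 1 / ((N : ℝ) + 2) := by positivity
    have h2 : 1 / ((N : ℝ) + 2) < 1 := by
      rw [div_lt_one (by positivity)]; linarith [(Nat.cast_nonneg N : (0 : ℝ) ≤ N)]
    constructor <;> simp only [hr] <;> linarith
  have hrlim : Tendsto r atTop (𝓝 1) := by
    have h1 : Tendsto (fun N : ℕ => 1 / ((N : ℝ) + 2)) atTop (𝓝 0) :=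
      tendsto_const_nhds.div_atTop (tendsto_atTop_add_const_right _ _ tendsto_natCast_atTop_atTop)
    simpa [hr] using h1.const_sub 1
  have hinj : ∀ t ∈ Ico (0 : ℝ) 1, ∀ N, (r N * t : ℂ) ∈ disc := by
    intro t ht N
    have := (hr01 N).1
    simp only [disc, mem_ball_zero_iff, norm_mul, Complex.norm_real, Real.norm_eq_abs,
        abs_of_pos this, abs_of_nonneg ht.1]
    nlinarith [(hr01 N).2, ht.1, ht.2]
  refine lintegral_enorm_le_of_tendsto (F := fun N (t : ℝ) => f (r N * t)) ?_ ?_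
    (fun N => key (r N) (hr01 N)) tendsto_const_nhds
  · intro N
    refine ContinuousOn.aestronglyMeasurable ?_ measurableSet_Ico
    exact hf.continuousOn.comp (by fun_prop) fun t ht => hinj t ht N
  · refine (ae_restrict_iff' measurableSet_Ico).2 (Eventually.of_forall fun t ht => ?_)
    have ht1 : (t : ℂ) ∈ disc := by simp [disc, abs_of_nonneg ht.1, ht.2]
    have hc : ContinuousAt f (t : ℂ) :=
      hf.continuousOn.continuousAt (Metric.isOpen_ball.mem_nhds ht1)
    refine hc.tendsto.comp ?_
    have : Tendsto (fun N => (r N : ℂ) * t) atTop (𝓝 ((1 : ℝ) * t)) :=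
      ((Complex.continuous_ofReal.tendsto 1).comp hrlim).mul_const _
    simpa using this

/-! ### Tails and moments of a radial weight -/

/-- The moments `∫_0^1 r^n ω(r) dr`. -/
def moment (ω : ℝ → ℝ) (n : ℕ) : ℝ := ∫ r in Ico (0 : ℝ) 1, r ^ n * ω r

/-- The function `t ↦ 1 + ∫_0^t ds / ω̂(s)`. -/
def tailWeight (ω : ℝ → ℝ) (t : ℝ) : ℝ := 1 + ∫ s in (0 : ℝ)..t, 1 / tail ω s

lemma tail_eq_setIntegral (ω : ℝ → ℝ) {r : ℝ} (hr : r ≤ 1) : tail ω r = ∫ s in Ico r 1, ω s := by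
  rw [tail, intervalIntegral.integral_of_le hr, integral_Ico_eq_integral_Ioc]

namespace IsRadialWeight

lemma intervalIntegrable {ω : ℝ → ℝ} (hω : IsRadialWeight ω)
    {a b : ℝ} (ha : a ∈ Icc (0 : ℝ) 1) (hb : b ∈ Icc (0 : ℝ) 1) :
    IntervalIntegrable ω volume a b := by
  have h : IntervalIntegrable ω volume 0 1 :=
    (intervalIntegrable_iff_integrableOn_Ico_of_le zero_le_one).2 hω.integrable
  refine h.mono_set (uIcc_subset_uIcc ?_ ?_) <;> simpa [uIcc_of_le]

lemma tail_antitoneOn {ω : ℝ → ℝ} (hω : IsRadialWeight ω) : AntitoneOn (tail ω) (Icc 0 1) := by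
  intro r hr s hs hrs
  have h1 := intervalIntegral.integral_add_adjacent_intervals (hω.intervalIntegrable hr hs)
    (hω.intervalIntegrable hs (right_mem_Icc.2 zero_le_one))
  have h2 : 0 ≤ ∫ x in r..s, ω x := by
    rw [intervalIntegral.integral_of_le hrs, ← integral_Ico_eq_integral_Ioc]
    exact setIntegral_nonneg measurableSet_Ico fun x hx =>
      hω.nonneg x ⟨hr.1.trans hx.1, hx.2.trans_le hs.2⟩
  simp only [tail]
  linarith

lemma tail_anti {ω : ℝ → ℝ} (hω : IsRadialWeight ω)
    {r s : ℝ} (hr : 0 ≤ r) (hrs : r ≤ s) (hs : s ≤ 1) : tail ω s ≤ tail ω r :=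
  hω.tail_antitoneOn ⟨hr, hrs.trans hs⟩ ⟨hr.trans hrs, hs⟩ hrs

lemma continuousOn_tail {ω : ℝ → ℝ} (hω : IsRadialWeight ω) : ContinuousOn (tail ω) (Icc 0 1) := by
  have h := intervalIntegral.continuousOn_primitive_interval_left (μ := volume) (f := ω)
    (a := 0) (b := 1) (by
      rw [uIcc_of_le zero_le_one, integrableOn_Icc_iff_integrableOn_Ico]; exact hω.integrable)
  rwa [uIcc_of_le zero_le_one] at h

lemma continuousOn_inv_tail {ω : ℝ → ℝ} (hω : IsRadialWeight ω)
    : ContinuousOn (fun s => 1 / tail ω s) (Ico 0 1) :=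
  continuousOn_const.div (hω.continuousOn_tail.mono Ico_subset_Icc_self)
    fun s hs => (hω.tail_pos s hs).ne'

lemma intervalIntegrable_inv_tail {ω : ℝ → ℝ} (hω : IsRadialWeight ω)
    {a b : ℝ} (ha : a ∈ Ico (0 : ℝ) 1) (hb : b ∈ Ico (0 : ℝ) 1) :
    IntervalIntegrable (fun s => 1 / tail ω s) volume a b :=
  (hω.continuousOn_inv_tail.mono (ordConnected_Ico.uIcc_subset ha hb)).intervalIntegrable

lemma tailWeight_sub {ω : ℝ → ℝ} (hω : IsRadialWeight ω)
    {a b : ℝ} (ha : a ∈ Ico (0 : ℝ) 1) (hb : b ∈ Ico (0 : ℝ) 1) :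
    tailWeight ω b - tailWeight ω a = ∫ s in a..b, 1 / tail ω s := by
  have h0 : (0 : ℝ) ∈ Ico (0 : ℝ) 1 := by simp
  have := intervalIntegral.integral_add_adjacent_intervals (hω.intervalIntegrable_inv_tail h0 ha)
    (hω.intervalIntegrable_inv_tail ha hb)
  simp only [tailWeight]
  linarith

lemma div_tail_le_integral {ω : ℝ → ℝ} (hω : IsRadialWeight ω)
    {a b : ℝ} (ha : 0 ≤ a) (hab : a ≤ b) (hb : b < 1) :
    (b - a) / tail ω a ≤ ∫ s in a..b, 1 / tail ω s := by
  have h : ∫ s in a..b, 1 / tail ω a ≤ ∫ s in a..b, 1 / tail ω s := by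
    refine intervalIntegral.integral_mono_on hab intervalIntegrable_const
      (hω.intervalIntegrable_inv_tail ⟨ha, hab.trans_lt hb⟩ ⟨ha.trans hab, hb⟩) fun s hs => ?_
    exact one_div_le_one_div_of_le (hω.tail_pos s ⟨ha.trans hs.1, hs.2.trans_lt hb⟩)
      (hω.tail_anti ha hs.1 (hs.2.trans hb.le))
  simpa [div_eq_mul_inv] using h

lemma integral_le_div_tail {ω : ℝ → ℝ} (hω : IsRadialWeight ω)
    {a b : ℝ} (ha : 0 ≤ a) (hab : a ≤ b) (hb : b < 1) :
    ∫ s in a..b, 1 / tail ω s ≤ (b - a) / tail ω b := by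
  have h : ∫ s in a..b, 1 / tail ω s ≤ ∫ s in a..b, 1 / tail ω b := by
    refine intervalIntegral.integral_mono_on hab
      (hω.intervalIntegrable_inv_tail ⟨ha, hab.trans_lt hb⟩ ⟨ha.trans hab, hb⟩)
      intervalIntegrable_const fun s hs => ?_
    exact one_div_le_one_div_of_le (hω.tail_pos b ⟨ha.trans hab, hb⟩)
      (hω.tail_anti (ha.trans hs.1) hs.2 hb.le)
  simpa [div_eq_mul_inv] using h

lemma tailWeight_mono {ω : ℝ → ℝ} (hω : IsRadialWeight ω)
    {a b : ℝ} (ha : 0 ≤ a) (hab : a ≤ b) (hb : b < 1) :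
    tailWeight ω a ≤ tailWeight ω b := by
  have h1 := hω.tailWeight_sub ⟨ha, hab.trans_lt hb⟩ ⟨ha.trans hab, hb⟩
  have h2 := hω.div_tail_le_integral ha hab hb
  have h3 : 0 ≤ (b - a) / tail ω a :=
    div_nonneg (by linarith) (hω.tail_pos a ⟨ha, hab.trans_lt hb⟩).le
  linarith

lemma one_le_tailWeight {ω : ℝ → ℝ} (hω : IsRadialWeight ω)
    {a : ℝ} (ha : a ∈ Ico (0 : ℝ) 1) : 1 ≤ tailWeight ω a := by
  have := hω.tailWeight_mono le_rfl ha.1 ha.2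
  simpa [tailWeight] using this

lemma continuousOn_tailWeight {ω : ℝ → ℝ} (hω : IsRadialWeight ω)
    : ContinuousOn (tailWeight ω) (Ico 0 1) := by
  intro t ht
  set b := (t + 1) / 2 with hb
  have hb1 : b < 1 := by linarith [ht.2]
  have htb : t < b := by linarith [ht.2]
  have h := intervalIntegral.continuousOn_primitive_interval (μ := volume)
    (f := fun s => 1 / tail ω s) (a := 0) (b := b) (by
      rw [uIcc_of_le (ht.1.trans htb.le)]
      exact (hω.continuousOn_inv_tail.mono fun s hs =>
        ⟨hs.1, hs.2.trans_lt hb1⟩).integrableOn_compact isCompact_Icc)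
  rw [uIcc_of_le (ht.1.trans htb.le)] at h
  have h2 : ContinuousWithinAt (tailWeight ω) (Icc 0 b) t :=
    continuousWithinAt_const.add (h t ⟨ht.1, htb.le⟩)
  refine h2.mono_of_mem_nhdsWithin ?_
  filter_upwards [self_mem_nhdsWithin, mem_nhdsWithin_of_mem_nhds (Iio_mem_nhds htb)] with s hs hs'
  exact ⟨hs.1, le_of_lt hs'⟩

lemma integrableOn_pow_mul {ω : ℝ → ℝ} (hω : IsRadialWeight ω) (n : ℕ) :
    IntegrableOn (fun r => r ^ n * ω r) (Ico 0 1) volume := by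
  refine Integrable.mono' hω.integrable
    ((by fun_prop : Continuous fun r : ℝ => r ^ n).aestronglyMeasurable.mul hω.integrable.1) ?_
  refine (ae_restrict_iff' measurableSet_Ico).2 (Eventually.of_forall fun r hr => ?_)
  have h1 := hω.nonneg r hr
  rw [norm_mul, Real.norm_of_nonneg h1, Real.norm_of_nonneg (pow_nonneg hr.1 n)]
  exact mul_le_of_le_one_left h1 (pow_le_one₀ hr.1 hr.2.le)

lemma pow_mul_tail_le_moment {ω : ℝ → ℝ} (hω : IsRadialWeight ω)
    {u : ℝ} (hu : u ∈ Ico (0 : ℝ) 1) (n : ℕ) :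
    u ^ n * tail ω u ≤ moment ω n := by
  rw [tail_eq_setIntegral ω hu.2.le, ← integral_const_mul, moment]
  have hsub : Ico u 1 ⊆ Ico 0 1 := Ico_subset_Ico_left hu.1
  calc ∫ r in Ico u 1, u ^ n * ω r ≤ ∫ r in Ico u 1, r ^ n * ω r := by
        refine setIntegral_mono_on ((hω.integrable.mono_set hsub).const_mul _)
          ((hω.integrableOn_pow_mul n).mono_set hsub) measurableSet_Ico fun r hr => ?_
        have := hω.nonneg r (hsub hr)
        have := hu.1
        gcongr
        exact hr.1
    _ ≤ _ := by
        refine setIntegral_mono_set (hω.integrableOn_pow_mul n) ?_ hsub.eventuallyLE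
        refine (ae_restrict_iff' measurableSet_Ico).2 (Eventually.of_forall fun r hr => ?_)
        exact mul_nonneg (pow_nonneg hr.1 n) (hω.nonneg r hr)

lemma moment_pos {ω : ℝ → ℝ} (hω : IsRadialWeight ω) (n : ℕ) : 0 < moment ω n := by
  have h : (1 / 2 : ℝ) ∈ Ico (0 : ℝ) 1 := by constructor <;> norm_num
  refine lt_of_lt_of_le ?_ (hω.pow_mul_tail_le_moment h n)
  have := hω.tail_pos _ h
  positivity

lemma moment_mono_of_le {ω : ℝ → ℝ} (hω : IsRadialWeight ω)
    {f g : ℝ → ℝ} (hf : IntegrableOn (fun r => f r * ω r) (Ico 0 1))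
    (hg : IntegrableOn (fun r => g r * ω r) (Ico 0 1)) (h : ∀ r ∈ Ico (0 : ℝ) 1, f r ≤ g r) :
    ∫ r in Ico (0 : ℝ) 1, f r * ω r ≤ ∫ r in Ico (0 : ℝ) 1, g r * ω r :=
  setIntegral_mono_on hf hg measurableSet_Ico fun r hr =>
    mul_le_mul_of_nonneg_right (h r hr) (hω.nonneg r hr)

lemma moment_antitone {ω : ℝ → ℝ} (hω : IsRadialWeight ω) : Antitone (moment ω) := fun _ _ hnm =>
  hω.moment_mono_of_le (hω.integrableOn_pow_mul _) (hω.integrableOn_pow_mul _) fun _ hr =>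
    pow_le_pow_of_le_one hr.1 hr.2.le hnm

/-- Split at `u`: beyond `u` the power is at most `1`, before `u` the factor `r^k` is at most `u^k`.
-/
lemma moment_add_le {ω : ℝ → ℝ} (hω : IsRadialWeight ω) {u : ℝ} (hu : u ∈ Ico (0 : ℝ) 1) (n k : ℕ) :
    moment ω (n + k) ≤ tail ω u + u ^ k * moment ω n := by
  have hsplit : Ico (0 : ℝ) 1 = Ico 0 u ∪ Ico u 1 := (Ico_union_Ico_eq_Ico hu.1 hu.2.le).symm
  have hs1 : Ico (0 : ℝ) u ⊆ Ico 0 1 := Ico_subset_Ico_right hu.2.le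
  have hs2 : Ico u (1 : ℝ) ⊆ Ico 0 1 := Ico_subset_Ico_left hu.1
  have h1 : moment ω (n + k) = (∫ r in Ico (0 : ℝ) u, r ^ (n + k) * ω r) +
      ∫ r in Ico u (1 : ℝ), r ^ (n + k) * ω r := by
    rw [moment, hsplit]
    exact setIntegral_union (Ico_disjoint_Ico_same) measurableSet_Ico
      ((hω.integrableOn_pow_mul _).mono_set hs1) ((hω.integrableOn_pow_mul _).mono_set hs2)
  have h2 : ∫ r in Ico u (1 : ℝ), r ^ (n + k) * ω r ≤ tail ω u := by
    rw [tail_eq_setIntegral ω hu.2.le]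
    refine setIntegral_mono_on ((hω.integrableOn_pow_mul _).mono_set hs2)
      (hω.integrable.mono_set hs2) measurableSet_Ico fun r hr => ?_
    exact mul_le_of_le_one_left (hω.nonneg r (hs2 hr))
      (pow_le_one₀ (hs2 hr).1 hr.2.le)
  have h3 : ∫ r in Ico (0 : ℝ) u, r ^ (n + k) * ω r ≤ u ^ k * moment ω n := by
    calc ∫ r in Ico (0 : ℝ) u, r ^ (n + k) * ω r
        ≤ ∫ r in Ico (0 : ℝ) u, u ^ k * (r ^ n * ω r) := by
          refine setIntegral_mono_on ((hω.integrableOn_pow_mul _).mono_set hs1)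
            (((hω.integrableOn_pow_mul n).mono_set hs1).const_mul _) measurableSet_Ico
            fun r hr => ?_
          have := hω.nonneg r (hs1 hr)
          have h0 := hr.1
          have h4 : r ^ k ≤ u ^ k := by gcongr; exact hr.2.le
          have h5 : 0 ≤ r ^ n * ω r := by positivity
          calc r ^ (n + k) * ω r = r ^ k * (r ^ n * ω r) := by ring
            _ ≤ _ := mul_le_mul_of_nonneg_right h4 h5
      _ = u ^ k * ∫ r in Ico (0 : ℝ) u, r ^ n * ω r := integral_const_mul _ _
      _ ≤ _ := by
          refine mul_le_mul_of_nonneg_left ?_ (pow_nonneg hu.1 k)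
          refine setIntegral_mono_set (hω.integrableOn_pow_mul n) ?_ hs1.eventuallyLE
          refine (ae_restrict_iff' measurableSet_Ico).2 (Eventually.of_forall fun r hr => ?_)
          exact mul_nonneg (pow_nonneg hr.1 n) (hω.nonneg r hr)
  linarith

/-- The difference of powers is `r^(n-1) (1 + r) · r^n (1 - r)`, and `n r^n (1 - r) ≤ 1`. The gain
`1/n` is what makes differences of consecutive kernel coefficients comparable to `avgCoeff`. -/
lemma moment_sub_le {ω : ℝ → ℝ} (hω : IsRadialWeight ω) {n : ℕ} (hn : 1 ≤ n) :
    moment ω (2 * n - 1) - moment ω (2 * n + 1) ≤ 2 / n * moment ω (n - 1) := by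
  have h1 : moment ω (2 * n - 1) - moment ω (2 * n + 1) =
      ∫ r in Ico (0 : ℝ) 1, (r ^ (2 * n - 1) - r ^ (2 * n + 1)) * ω r := by
    simp only [moment, sub_mul]
    rw [integral_sub (hω.integrableOn_pow_mul _) (hω.integrableOn_pow_mul _)]
  have h2 : 2 / n * moment ω (n - 1) =
      ∫ r in Ico (0 : ℝ) 1, (2 / n * r ^ (n - 1)) * ω r := by
    simp only [moment, ← integral_const_mul, mul_assoc]
  rw [h1, h2]
  refine hω.moment_mono_of_le ?_ ?_ fun r hr => ?_
  · simp only [sub_mul]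
    exact (hω.integrableOn_pow_mul _).sub (hω.integrableOn_pow_mul _)
  · simp only [mul_assoc]
    exact (hω.integrableOn_pow_mul _).const_mul _
  · have h0 := hr.1
    have hr1 := hr.2
    obtain ⟨k, rfl⟩ : ∃ k, n = k + 1 := ⟨n - 1, by lia⟩
    have e1 : 2 * (k + 1) - 1 = k + (k + 1) := by lia
    have e2 : 2 * (k + 1) + 1 = k + (k + 1) + 2 := by lia
    rw [e1, e2, Nat.add_sub_cancel]
    have hb : ((k + 1 : ℕ) : ℝ) * (r ^ (k + 1) * (1 - r)) ≤ 1 := by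
      -- Each term of the geometric sum is at least `r^(k+1)`, and the sum times `1 - r` is at most
      -- `1`.
      have hgeo : ((k + 1 : ℕ) : ℝ) * r ^ (k + 1) ≤ ∑ i ∈ Finset.range (k + 1), r ^ i := by
        have : ∑ i ∈ Finset.range (k + 1), r ^ (k + 1) ≤ ∑ i ∈ Finset.range (k + 1), r ^ i :=
          Finset.sum_le_sum fun i hi =>
            pow_le_pow_of_le_one h0 hr1.le (Finset.mem_range.1 hi).le
        simpa using this
      have h3 := geom_sum_mul_neg r (k + 1)
      have h4 : 0 ≤ r ^ (k + 1) := by positivity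
      nlinarith
    have hkpos : (0 : ℝ) < ((k + 1 : ℕ) : ℝ) := by positivity
    rw [div_mul_eq_mul_div, le_div_iff₀ hkpos]
    have h5 : r ^ k * (1 + r) * (((k + 1 : ℕ) : ℝ) * (r ^ (k + 1) * (1 - r))) ≤
        r ^ k * (1 + r) * 1 := by gcongr
    have h6 : r ^ k * (1 + r) ≤ r ^ k * 2 := by gcongr; linarith
    calc (r ^ (k + (k + 1)) - r ^ (k + (k + 1) + 2)) * ((k + 1 : ℕ) : ℝ)
        = r ^ k * (1 + r) * (((k + 1 : ℕ) : ℝ) * (r ^ (k + 1) * (1 - r))) := by ring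
      _ ≤ _ := by linarith

end IsRadialWeight

/-! ### Comparison of moments with tails -/

lemma quarter_le_pow (m : ℕ) : (1 / 4 : ℝ) ≤ (1 - 1 / ((m : ℝ) + 1)) ^ m := by
  rcases Nat.eq_zero_or_pos m with rfl | hm
  · norm_num
  have hm' : (0 : ℝ) < m := by exact_mod_cast hm
  -- The power equals `(1 + 1/m)^(-m)`, which is at least `1/e`.
  have h1 : 1 - 1 / ((m : ℝ) + 1) = (1 + 1 / (m : ℝ))⁻¹ := by field_simp; ring
  rw [h1, inv_pow, one_div]
  apply inv_anti₀ (by positivity)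
  have h2 : (1 + 1 / (m : ℝ)) ≤ Real.exp (1 / m) := by
    linarith [Real.add_one_le_exp (1 / (m : ℝ))]
  calc (1 + 1 / (m : ℝ)) ^ m ≤ Real.exp (1 / m) ^ m := by gcongr
    _ = Real.exp 1 := by rw [← Real.exp_nat_mul]; congr 1; field_simp
    _ ≤ 4 := by linarith [Real.exp_one_lt_d9]

lemma one_sub_one_div_mem (m : ℕ) : 1 - 1 / ((m : ℝ) + 1) ∈ Ico (0 : ℝ) 1 := by
  have h1 : (0 : ℝ) < 1 / ((m : ℝ) + 1) := by positivity
  have h2 : 1 / ((m : ℝ) + 1) ≤ 1 := by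
    rw [div_le_one (by positivity)]; linarith [(Nat.cast_nonneg m : (0 : ℝ) ≤ m)]
  constructor <;> linarith

lemma IsRadialWeight.tail_le_moment {ω : ℝ → ℝ} (hω : IsRadialWeight ω) (m : ℕ) :
    tail ω (1 - 1 / ((m : ℝ) + 1)) ≤ 4 * moment ω m := by
  have h1 := hω.pow_mul_tail_le_moment (one_sub_one_div_mem m) m
  have h2 := mul_le_mul_of_nonneg_right (quarter_le_pow m)
    (hω.tail_pos _ (one_sub_one_div_mem m)).le
  linarith

section Doubling

variable {ω : ℝ → ℝ} {C : ℝ}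

lemma tail_le_pow_mul (hC : 1 ≤ C)
    (hd : ∀ r ∈ Ico (0 : ℝ) 1, tail ω r ≤ C * tail ω ((1 + r) / 2)) {r : ℝ}
    (hr : r ∈ Ico (0 : ℝ) 1) (j : ℕ) : tail ω r ≤ C ^ j * tail ω (1 - (1 - r) / 2 ^ j) := by
  induction j with
  | zero => simp
  | succ j ih =>
    have hmem : 1 - (1 - r) / 2 ^ j ∈ Ico (0 : ℝ) 1 := by
      have h1 : 0 < (1 - r) / 2 ^ j := by have := hr.2; apply div_pos <;> [linarith; positivity]
      have h2 : (1 - r) / 2 ^ j ≤ 1 := by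
        rw [div_le_one (by positivity)]
        linarith [hr.1, one_le_pow₀ (M₀ := ℝ) (a := 2) (n := j) (by norm_num)]
      constructor <;> linarith
    have h3 := hd _ hmem
    have h4 : (1 + (1 - (1 - r) / 2 ^ j)) / 2 = 1 - (1 - r) / 2 ^ (j + 1) := by
      rw [pow_succ]; field_simp; ring
    rw [h4] at h3
    calc tail ω r ≤ _ := ih
      _ ≤ C ^ j * (C * tail ω (1 - (1 - r) / 2 ^ (j + 1))) := by gcongr
      _ = _ := by ring

/-- For doubling weights the moments are controlled by the tails. -/
lemma exists_moment_le_tail (hω : IsRadialWeight ω) (hC : 1 ≤ C)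
    (hd : ∀ r ∈ Ico (0 : ℝ) 1, tail ω r ≤ C * tail ω ((1 + r) / 2)) :
    ∃ K : ℝ, 0 < K ∧ ∀ m : ℕ, moment ω m ≤ K * tail ω (1 - 1 / ((m : ℝ) + 1)) := by
  -- The choice `2^j > 8 C` gives `exp(-2^j / 4) ≤ 1 / (2 C)`, the contraction factor that closes
  -- the induction below.
  obtain ⟨j, hj⟩ := pow_unbounded_of_one_lt (8 * C) (one_lt_two : (1 : ℝ) < 2)
  have hCj : 0 < C ^ j := by positivity
  refine ⟨2 * C ^ j, by positivity, fun m => ?_⟩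
  induction m using Nat.strong_induction_on with
  | _ m ih =>
  have hum := one_sub_one_div_mem m
  have htpos := hω.tail_pos _ hum
  have hm1 : (0 : ℝ) < (m : ℝ) + 1 := by positivity
  -- For `m + 1 < 2^j` the bound follows from `j` doublings starting at `0`. Otherwise the moment is
  -- split at `u = 1 - 2^j/(m+1)`: the outer part costs `j` doublings, hence `C^j`. The inner part
  -- is at most `u^(m-q)` times the moment of order `q = m/2`; the induction hypothesis and one more
  -- doubling bound it by the same amount, and the total is `2 C^j`.
  rcases lt_or_ge ((m : ℝ) + 1) (2 ^ j) with hlt | hge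
  · have h1 : moment ω m ≤ tail ω 0 := by
      refine (hω.moment_antitone (Nat.zero_le m)).trans (le_of_eq ?_)
      rw [tail_eq_setIntegral ω zero_le_one]; simp [moment]
    have h2 := tail_le_pow_mul hC hd (r := 0) (by simp) j
    have h3 : tail ω (1 - (1 - 0) / 2 ^ j) ≤ tail ω (1 - 1 / ((m : ℝ) + 1)) := by
      have : (1 : ℝ) / 2 ^ j ≤ 1 / ((m : ℝ) + 1) := one_div_le_one_div_of_le hm1 hlt.le
      have h5 : (0 : ℝ) < 1 / 2 ^ j := by positivity
      refine hω.tail_anti hum.1 ?_ ?_ <;> simp only [sub_zero] <;> linarith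
    nlinarith [mul_le_mul_of_nonneg_left h3 hCj.le, mul_pos hCj htpos]
  · have hm : 1 ≤ m := by
      by_contra h
      have : m = 0 := by lia
      subst this
      norm_num at hge; linarith
    set q := m / 2 with hq
    have hqm : q < m := by lia
    set u := 1 - 2 ^ j / ((m : ℝ) + 1) with hu
    have hu01 : u ∈ Ico (0 : ℝ) 1 := by
      have h1 : 2 ^ j / ((m : ℝ) + 1) ≤ 1 := by rwa [div_le_one hm1]
      have h2 : 0 < 2 ^ j / ((m : ℝ) + 1) := by positivity
      constructor <;> linarith
    have h1 := hω.moment_add_le hu01 q (m - q)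
    rw [show q + (m - q) = m by lia] at h1
    have h2 : tail ω u ≤ C ^ j * tail ω (1 - 1 / ((m : ℝ) + 1)) := by
      have := tail_le_pow_mul hC hd hu01 j
      convert this using 3
      simp only [hu]; field_simp; ring
    have h3 : u ^ (m - q) ≤ 1 / (2 * C) := by
      have h4 : u ≤ Real.exp (-(2 ^ j / ((m : ℝ) + 1))) := by
        linarith [Real.add_one_le_exp (-(2 ^ j / ((m : ℝ) + 1)))]
      calc u ^ (m - q) ≤ Real.exp (-(2 ^ j / ((m : ℝ) + 1))) ^ (m - q) := by
            gcongr; exact hu01.1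
        _ = Real.exp (-(((m - q : ℕ) : ℝ) * (2 ^ j / ((m : ℝ) + 1)))) := by
            rw [← Real.exp_nat_mul]; congr 1; ring
        _ ≤ Real.exp (-(2 ^ j / 4)) := by
            apply Real.exp_le_exp.2
            have h5 : ((m : ℝ) + 1) / 4 ≤ ((m - q : ℕ) : ℝ) := by
              have : m + 1 ≤ 4 * (m - q) := by lia
              have : ((m + 1 : ℕ) : ℝ) ≤ ((4 * (m - q) : ℕ) : ℝ) := by exact_mod_cast this
              push_cast at this
              linarith
            have h6 : ((m : ℝ) + 1) / 4 * (2 ^ j / ((m : ℝ) + 1)) ≤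
              ((m - q : ℕ) : ℝ) * (2 ^ j / ((m : ℝ) + 1)) := by gcongr
            have h7 : ((m : ℝ) + 1) / 4 * (2 ^ j / ((m : ℝ) + 1)) = 2 ^ j / 4 := by field_simp
            linarith
        _ ≤ 1 / (2 * C) := by
            rw [Real.exp_neg, one_div]
            apply inv_anti₀ (by positivity)
            linarith [Real.add_one_le_exp ((2 : ℝ) ^ j / 4)]
    have h4 : tail ω (1 - 1 / ((q : ℝ) + 1)) ≤ C * tail ω (1 - 1 / ((m : ℝ) + 1)) := by
      refine (hd _ (one_sub_one_div_mem q)).trans ?_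
      gcongr
      have h5 : (1 + (1 - 1 / ((q : ℝ) + 1))) / 2 = 1 - 1 / (2 * ((q : ℝ) + 1)) := by
        field_simp; ring
      rw [h5]
      have h6 : (m : ℝ) + 1 ≤ 2 * ((q : ℝ) + 1) := by
        have : m + 1 ≤ 2 * (q + 1) := by lia
        exact_mod_cast this
      have h7 : 1 / (2 * ((q : ℝ) + 1)) ≤ 1 / ((m : ℝ) + 1) := one_div_le_one_div_of_le hm1 h6
      have h8 : 0 < 1 / (2 * ((q : ℝ) + 1)) := by positivity
      exact hω.tail_anti hum.1 (by linarith) (by linarith)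
    have h5 := ih q hqm
    have hC0 : 0 < C := by linarith
    calc moment ω m ≤ tail ω u + u ^ (m - q) * moment ω q := h1
      _ ≤ C ^ j * tail ω (1 - 1 / ((m : ℝ) + 1)) +
          1 / (2 * C) * (2 * C ^ j * (C * tail ω (1 - 1 / ((m : ℝ) + 1)))) := by
          have := hω.moment_pos q
          gcongr
          exact h5.trans (by gcongr)
      _ = _ := by field_simp; ring

end Doubling

/-! ### Integration in polar coordinates -/

lemma measurableSet_disc : MeasurableSet disc := Metric.isOpen_ball.measurableSet

/-- Integration over the disc in polar coordinates. -/
lemma integral_areaMeasure {G : ℂ → ℂ} (hG : Integrable G areaMeasure) :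
    ∫ ζ, G ζ ∂areaMeasure = ∫ r in Ioo (0 : ℝ) 1, ((2 * r : ℝ) : ℂ) * circleAverage G 0 r := by
  have hc : ENNReal.ofReal Real.pi⁻¹ ≠ 0 := by simp [Real.pi_pos]
  have hG1 : IntegrableOn G disc volume :=
    (integrable_smul_measure hc ENNReal.ofReal_ne_top).1 hG
  set H : ℂ → ℂ := disc.indicator G with hH
  have hHi : Integrable H volume := (integrable_indicator_iff measurableSet_disc).2 hG1
  have h1 : ∫ ζ, G ζ ∂areaMeasure = (Real.pi⁻¹ : ℝ) • ∫ ζ, H ζ := by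
    rw [areaMeasure, integral_smul_measure, ENNReal.toReal_ofReal (by positivity), hH,
      integral_indicator measurableSet_disc]
  rw [h1, ← Complex.integral_comp_polarCoord_symm]
  -- Integrability in polar coordinates is needed for Fubini; it comes from the change of variables
  -- formula.
  have hint : IntegrableOn (fun p : ℝ × ℝ => p.1 • H (Complex.polarCoord.symm p))
      polarCoord.target volume := by
    have h2 : Integrable (fun p : ℝ × ℝ => H (Complex.measurableEquivRealProd.symm p)) volume :=
      (Complex.volume_preserving_equiv_real_prod.symm.integrable_comp_emb
        Complex.measurableEquivRealProd.symm.measurableEmbedding).2 hHi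
    have h3 := (integrableOn_image_iff_integrableOn_abs_det_fderiv_smul volume
      (measurableSet_Ioi.prod measurableSet_Ioo)
      (fun p _ => (hasFDerivAt_polarCoord_symm p).hasFDerivWithinAt) polarCoord.symm.injOn
      (fun p : ℝ × ℝ => H (Complex.measurableEquivRealProd.symm p))).1 h2.integrableOn
    refine h3.congr_fun (fun p hp => ?_) (measurableSet_Ioi.prod measurableSet_Ioo)
    have hp1 : (0 : ℝ) < p.1 := hp.1
    simp only [det_fderivPolarCoordSymm, abs_of_pos hp1]
    rw [← Complex.measurableEquivRealProd_symm_polarCoord_symm_apply]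
  have ht : polarCoord.target = Ioi (0 : ℝ) ×ˢ Ioo (-Real.pi) Real.pi := rfl
  rw [ht] at hint ⊢
  rw [Measure.volume_eq_prod, setIntegral_prod _ hint, ← integral_smul]
  have h4 : ∀ r ∈ Ioi (0 : ℝ), (Real.pi⁻¹ : ℝ) • ∫ θ in Ioo (-Real.pi) Real.pi,
      (r, θ).1 • H (Complex.polarCoord.symm (r, θ)) =
      (Ioo (0 : ℝ) 1).indicator (fun r => ((2 * r : ℝ) : ℂ) * circleAverage G 0 r) r := by
    intro r (hr : 0 < r)
    have hmap (θ : ℝ) : Complex.polarCoord.symm (r, θ) = circleMap 0 r θ := by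
      simp [circleMap, Complex.exp_mul_I]
    simp_rw [hmap]
    by_cases hr1 : r < 1
    · rw [indicator_of_mem (by exact ⟨hr, hr1⟩), Real.circleAverage_eq_integral_add (-Real.pi),
        intervalIntegral.integral_comp_add_right (fun θ => G (circleMap 0 r θ)),
        ← integral_Ioc_eq_integral_Ioo, integral_smul]
      have e1 : 2 * Real.pi + -Real.pi = Real.pi := by ring
      rw [zero_add, e1, intervalIntegral.integral_of_le (by linarith [Real.pi_pos])]
      have e2 : ∀ θ, H (circleMap 0 r θ) = G (circleMap 0 r θ) := fun θ => by
        rw [hH, indicator_of_mem]; simp [disc, abs_of_pos hr, hr1]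
      simp_rw [e2]
      have := Real.pi_pos.ne'
      simp only [Complex.real_smul]
      push_cast
      field_simp
    · have e2 : ∀ θ, H (circleMap 0 r θ) = 0 := fun θ => by
        rw [hH, indicator_of_notMem]; simp [disc, abs_of_pos hr, not_lt.1 hr1]
      rw [indicator_of_notMem (fun h => hr1 h.2)]
      simp [e2]
  rw [setIntegral_congr_fun measurableSet_Ioi h4, setIntegral_indicator measurableSet_Ioo,
    inter_eq_self_of_subset_right Ioo_subset_Ioi_self]

/-! ### Integrability on the disc and the Taylor coefficients of the Bergman kernel -/

lemma ae_areaMeasure {P : ℂ → Prop} (h : ∀ z ∈ disc, P z) : ∀ᵐ z ∂areaMeasure, P z := by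
  refine Measure.ae_smul_measure ?_ _
  exact (ae_restrict_iff' measurableSet_disc).2 (Eventually.of_forall h)

lemma aestronglyMeasurable_areaMeasure {f : ℂ → ℂ} (hf : ContinuousOn f disc) :
    AEStronglyMeasurable f areaMeasure :=
  (hf.aestronglyMeasurable measurableSet_disc).smul_measure _

lemma IsRadialWeight.integrable_areaMeasure {ω : ℝ → ℝ} (hω : IsRadialWeight ω) :
    Integrable (fun ζ : ℂ => ω ‖ζ‖) areaMeasure := by
  refine Integrable.smul_measure ?_ ENNReal.ofReal_ne_top
  have := (integrableOn_fun_norm_addHaar (E := ℂ) volume (f := ω) (r := 1)).2 (by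
    simpa using (hω.integrableOn_pow_mul 1).mono_set Ioo_subset_Ico_self)
  exact this

lemma integrable_conj_pow_mul {f : ℂ → ℂ} (hf : Integrable f areaMeasure) (n : ℕ) :
    Integrable (fun ζ => conj ζ ^ n * f ζ) areaMeasure := by
  refine hf.bdd_mul (c := 1) (Complex.continuous_conj.pow n).aestronglyMeasurable
    (ae_areaMeasure fun z hz => ?_)
  have hz1 : ‖z‖ < 1 := by simpa [disc] using hz
  simpa using pow_le_one₀ (norm_nonneg z) hz1.le

/-- The `n`-th Taylor coefficient as an integral over the disc. -/
lemma integral_conj_pow_mul {ω : ℝ → ℝ} {a : ℕ → ℂ} {f : ℂ → ℂ}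
    (ha : ∀ z ∈ disc, HasSum (fun n => a n * z ^ n) (f z))
    (hf : Integrable (fun ζ => f ζ * (ω ‖ζ‖ : ℂ)) areaMeasure) (n : ℕ) :
    ∫ ζ, conj ζ ^ n * (f ζ * (ω ‖ζ‖ : ℂ)) ∂areaMeasure = 2 * moment ω (2 * n + 1) * a n := by
  rw [integral_areaMeasure (integrable_conj_pow_mul hf n)]
  have h1 : ∀ r ∈ Ioo (0 : ℝ) 1, ((2 * r : ℝ) : ℂ) *
      circleAverage (fun ζ => conj ζ ^ n * (f ζ * (ω ‖ζ‖ : ℂ))) 0 r =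
      (2 * a n) * ((r ^ (2 * n + 1) * ω r : ℝ) : ℂ) := by
    intro r hr
    have hin : ∀ z : ℂ, ‖z‖ = r → z ∈ disc := fun z hz => by simp [disc, hz, hr.2]
    have h2 : circleAverage (fun ζ => conj ζ ^ n * (f ζ * (ω ‖ζ‖ : ℂ))) 0 r =
        circleAverage (fun ζ => (ω r : ℂ) • (f ζ * conj ζ ^ n)) 0 r := by
      refine Real.circleAverage_congr_sphere fun z hz => ?_
      rw [mem_sphere_zero_iff_norm, abs_of_pos hr.1] at hz
      simp only [hz, smul_eq_mul]; ring
    rw [h2, Real.circleAverage_fun_smul, circleAverage_mul_conj_pow hr.1.le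
      (summable_norm_of_hasSum_disc ha hr.1.le hr.2) (fun z hz => ha z (hin z hz)) n]
    simp only [smul_eq_mul]
    push_cast; ring
  rw [setIntegral_congr_fun measurableSet_Ioo h1, integral_const_mul, integral_complex_ofReal,
    moment, integral_Ico_eq_integral_Ioo]
  ring

/-- The Taylor coefficients of the Bergman kernel. -/
def kernelCoeff (ω : ℝ → ℝ) (n : ℕ) : ℝ := 1 / (2 * moment ω (2 * n + 1))

/-- The weighted area measure is finite, and `|f| ≤ |f|² + 1`. -/
lemma MemBergman2.integrable_mul {ω : ℝ → ℝ} (hω : IsRadialWeight ω)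
    {f : ℂ → ℂ} (hf : MemBergman2 ω f) :
    Integrable (fun ζ => f ζ * (ω ‖ζ‖ : ℂ)) areaMeasure := by
  have hm : AEStronglyMeasurable (fun ζ => f ζ * (ω ‖ζ‖ : ℂ)) areaMeasure :=
    (aestronglyMeasurable_areaMeasure hf.analytic.continuousOn).mul
      (Complex.continuous_ofReal.comp_aestronglyMeasurable hω.integrable_areaMeasure.1)
  refine (hf.integrable.add hω.integrable_areaMeasure).mono' hm (ae_areaMeasure fun z hz => ?_)
  have hz1 : ‖z‖ < 1 := by simpa [disc] using hz
  have hw := hω.nonneg ‖z‖ ⟨norm_nonneg z, hz1⟩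
  rw [norm_mul, Complex.norm_real, Real.norm_of_nonneg hw]
  simp only [Pi.add_apply]
  nlinarith [sq_nonneg (‖f z‖ - 1), norm_nonneg (f z), mul_nonneg hw (sq_nonneg (‖f z‖ - 1))]

lemma IsRadialWeight.kernelCoeff_pos {ω : ℝ → ℝ} (hω : IsRadialWeight ω)
    (n : ℕ) : 0 < kernelCoeff ω n := by
  have := hω.moment_pos (2 * n + 1)
  unfold kernelCoeff; positivity

lemma IsRadialWeight.summable_kernelCoeff {ω : ℝ → ℝ} (hω : IsRadialWeight ω)
    {y : ℝ} (h0 : 0 ≤ y) (h1 : y < 1) :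
    Summable fun n => kernelCoeff ω n * y ^ n := by
  set u := (1 + y) / 2 with hu
  have hu01 : u ∈ Ico (0 : ℝ) 1 := by constructor <;> linarith
  have hupos : 0 < u := by linarith
  -- With `u² > y`, the bound `moment ω (2n+1) ≥ u^(2n+1) tail ω u` gives a geometric majorant of
  -- ratio `y / u² < 1`.
  have hyu : y < u ^ 2 := by
    have : 0 < (1 - y) ^ 2 := pow_pos (by linarith) 2
    rw [hu]; nlinarith
  have htp := hω.tail_pos u hu01
  have hgeo : Summable fun n : ℕ => 1 / (2 * (u * tail ω u)) * (y / u ^ 2) ^ n :=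
    (summable_geometric_of_lt_one (by positivity)
      (by rwa [div_lt_one (by positivity)])).mul_left _
  refine Summable.of_nonneg_of_le
    (fun n => mul_nonneg (hω.kernelCoeff_pos n).le (pow_nonneg h0 n)) (fun n => ?_) hgeo
  have h2 := hω.pow_mul_tail_le_moment hu01 (2 * n + 1)
  have h3 : kernelCoeff ω n ≤ 1 / (2 * (u ^ (2 * n + 1) * tail ω u)) := by
    unfold kernelCoeff
    exact one_div_le_one_div_of_le (by positivity) (by linarith)
  calc kernelCoeff ω n * y ^ n ≤ 1 / (2 * (u ^ (2 * n + 1) * tail ω u)) * y ^ n := by gcongr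
    _ = _ := by
      rw [div_pow y, ← pow_mul, pow_succ u]
      field_simp

/-- The kernel is written down as a power series. It is bounded on the disc because `t < 1`;
integrating termwise against `f` returns the Taylor series of `f` at `t`, since `2 * moment ω
(2n+1)` cancels against `kernelCoeff`. -/
lemma IsRadialWeight.exists_isReproducingKernelAt {ω : ℝ → ℝ} (hω : IsRadialWeight ω)
    {t : ℝ} (ht : t ∈ Ico (0 : ℝ) 1) :
    ∃ g, IsReproducingKernelAt ω t g := by
  have hsum := hω.summable_kernelCoeff ht.1 ht.2
  set c : ℕ → ℝ := fun n => kernelCoeff ω n * t ^ n with hc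
  have hc0 : ∀ n, 0 ≤ c n := fun n => mul_nonneg (hω.kernelCoeff_pos n).le (pow_nonneg ht.1 n)
  have hterm : ∀ n, ∀ z ∈ disc, ‖(c n : ℂ) * z ^ n‖ ≤ c n := by
    intro n z hz
    have hz1 : ‖z‖ < 1 := by simpa [disc] using hz
    rw [norm_mul, norm_pow, Complex.norm_real, Real.norm_of_nonneg (hc0 n)]
    exact mul_le_of_le_one_right (hc0 n) (pow_le_one₀ (norm_nonneg z) hz1.le)
  set g : ℂ → ℂ := fun z => ∑' n, (c n : ℂ) * z ^ n with hg
  have hgd : DifferentiableOn ℂ g disc :=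
    Complex.differentiableOn_tsum_of_summable_norm hsum (fun n => by fun_prop)
      Metric.isOpen_ball hterm
  have hgb : ∀ z ∈ disc, ‖g z‖ ≤ ∑' n, c n := fun z hz =>
    tsum_of_norm_bounded hsum.hasSum fun n => hterm n z hz
  refine ⟨g, ⟨hgd, ?_⟩, fun f hf => ?_⟩
  · refine hω.integrable_areaMeasure.bdd_mul (c := (∑' n, c n) ^ 2)
      ((aestronglyMeasurable_areaMeasure hgd.continuousOn).norm.pow 2)
      (ae_areaMeasure fun z hz => ?_)
    rw [norm_pow, norm_norm]
    gcongr
    exact hgb z hz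
  · obtain ⟨a, ha⟩ := exists_hasSum_of_differentiableOn hf.analytic
    have hfi := hf.integrable_mul hω
    have hcb (n : ℕ) : ∀ z ∈ disc, ‖conj z ^ n‖ ≤ 1 := fun z hz => by
      have hz1 : ‖z‖ < 1 := by simpa [disc] using hz
      simpa using pow_le_one₀ (norm_nonneg z) hz1.le
    have hFi (n : ℕ) : Integrable (fun ζ => (c n : ℂ) * (conj ζ ^ n * (f ζ * (ω ‖ζ‖ : ℂ))))
        areaMeasure :=
      (integrable_conj_pow_mul hfi n).const_mul _
    have hFs : Summable fun n =>
        ∫ ζ, ‖(c n : ℂ) * (conj ζ ^ n * (f ζ * (ω ‖ζ‖ : ℂ)))‖ ∂areaMeasure := by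
      refine Summable.of_nonneg_of_le (fun n => integral_nonneg fun ζ => norm_nonneg _)
        (fun n => ?_) (hsum.mul_right (∫ ζ, ‖f ζ * (ω ‖ζ‖ : ℂ)‖ ∂areaMeasure))
      rw [← integral_const_mul]
      refine integral_mono_ae (hFi n).norm (hfi.norm.const_mul _) (ae_areaMeasure fun z hz => ?_)
      simp only
      rw [norm_mul, Complex.norm_real, Real.norm_of_nonneg (hc0 n), norm_mul (conj z ^ n)]
      exact mul_le_mul_of_nonneg_left (mul_le_of_le_one_left (norm_nonneg _) (hcb n z hz)) (hc0 n)
    have h1 := hasSum_integral_of_summable_integral_norm hFi hFs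
    simp_rw [integral_const_mul, integral_conj_pow_mul ha hfi] at h1
    have h2 : (fun n => (c n : ℂ) * (2 * moment ω (2 * n + 1) * a n)) =
        fun n => a n * (t : ℂ) ^ n := by
      ext n
      have : (moment ω (2 * n + 1) : ℂ) ≠ 0 := by exact_mod_cast (hω.moment_pos _).ne'
      simp only [hc, kernelCoeff]
      push_cast
      field_simp
    rw [h2] at h1
    have htd : (t : ℂ) ∈ disc := by simp [disc, abs_of_nonneg ht.1, ht.2]
    rw [(ha t htd).unique h1]
    refine integral_congr_ae (ae_areaMeasure fun z hz => ?_)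
    simp only [hg]
    rw [Complex.conj_tsum, mul_assoc, mul_comm (∑' n, _), ← mul_assoc, ← tsum_mul_left]
    refine tsum_congr fun n => ?_
    simp; ring

/-- The Taylor expansion of the Bergman kernel. -/
lemma IsRadialWeight.hasSum_bergmanKernel {ω : ℝ → ℝ} (hω : IsRadialWeight ω)
    {t : ℝ} (ht : t ∈ Ico (0 : ℝ) 1) {z : ℂ}
    (hz : z ∈ disc) :
    HasSum (fun n => (kernelCoeff ω n : ℂ) * (t * z) ^ n) (bergmanKernel ω t z) := by
  have hex := hω.exists_isReproducingKernelAt ht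
  have hB : IsReproducingKernelAt ω t (bergmanKernel ω t) := by
    rw [bergmanKernel, dif_pos hex]; exact hex.choose_spec
  obtain ⟨b, hb⟩ := exists_hasSum_of_differentiableOn hB.1.analytic
  -- Whichever kernel was chosen, its reproducing property on monomials determines its coefficients.
  have hcoeff (n : ℕ) : b n = kernelCoeff ω n * (t : ℂ) ^ n := by
    have hpow : MemBergman2 ω fun z => z ^ n := by
      refine ⟨by fun_prop, hω.integrable_areaMeasure.bdd_mul (c := 1)
        (by fun_prop : Continuous _).aestronglyMeasurable (ae_areaMeasure fun z hz => ?_)⟩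
      have hz1 : ‖z‖ < 1 := by simpa [disc] using hz
      rw [norm_pow, norm_norm, norm_pow, ← pow_mul]
      exact pow_le_one₀ (norm_nonneg z) hz1.le
    have h1 := congrArg conj (hB.2 _ hpow)
    rw [← integral_conj] at h1
    have h2 := integral_conj_pow_mul hb (hB.1.integrable_mul hω) n
    have h3 : (t : ℂ) ^ n = 2 * moment ω (2 * n + 1) * b n := by
      rw [← h2]
      simpa [mul_assoc] using h1
    have : (moment ω (2 * n + 1) : ℂ) ≠ 0 := by exact_mod_cast (hω.moment_pos _).ne'
    rw [h3, kernelCoeff]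
    push_cast
    field_simp
  have := hb z hz
  simp_rw [hcoeff] at this
  simpa [mul_pow, mul_assoc] using this

/-! ### Estimates for doubling weights -/

/-- The Taylor coefficients of the averaged kernel. -/
def avgCoeff (ω : ℝ → ℝ) (n : ℕ) : ℝ := kernelCoeff ω n / (n + 1)

/-- The Taylor coefficients of `(1 - z) ∑ kernelCoeff ω n * z ^ n`. -/
def kernelDiff (ω : ℝ → ℝ) : ℕ → ℝ
  | 0 => kernelCoeff ω 0
  | n + 1 => kernelCoeff ω (n + 1) - kernelCoeff ω n

lemma IsRadialWeight.avgCoeff_nonneg {ω : ℝ → ℝ} (hω : IsRadialWeight ω) (n : ℕ) :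
    0 ≤ avgCoeff ω n := by
  have := hω.kernelCoeff_pos n
  unfold avgCoeff; positivity

lemma IsRadialWeight.avgCoeff_le {ω : ℝ → ℝ} (hω : IsRadialWeight ω) (n : ℕ) :
    avgCoeff ω n ≤ kernelCoeff ω n :=
  div_le_self (hω.kernelCoeff_pos n).le (by linarith [(Nat.cast_nonneg n : (0 : ℝ) ≤ n)])

lemma IsRadialWeight.summable_avgCoeff {ω : ℝ → ℝ} (hω : IsRadialWeight ω) {y : ℝ} (h0 : 0 ≤ y)
    (h1 : y < 1) : Summable fun n => avgCoeff ω n * y ^ n :=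
  Summable.of_nonneg_of_le (fun n => mul_nonneg (hω.avgCoeff_nonneg n) (pow_nonneg h0 n))
    (fun n => mul_le_mul_of_nonneg_right (hω.avgCoeff_le n) (pow_nonneg h0 n))
    (hω.summable_kernelCoeff h0 h1)

lemma mul_integral_inv_tail (ω : ℝ → ℝ) (t : ℝ) :
    t * ∫ s in (0 : ℝ)..1, 1 / tail ω (t * s) = tailWeight ω t - 1 := by
  rw [intervalIntegral.mul_integral_comp_mul_left (f := fun s => 1 / tail ω s)]
  simp [tailWeight]

lemma IsRadialWeight.intervalIntegrable_inv_tail_mul {ω : ℝ → ℝ} (hω : IsRadialWeight ω)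
    {t : ℝ} (ht : t ∈ Ico (0 : ℝ) 1) :
    IntervalIntegrable (fun s => 1 / tail ω (t * s)) volume 0 1 := by
  refine ContinuousOn.intervalIntegrable ?_
  rw [uIcc_of_le zero_le_one]
  refine hω.continuousOn_inv_tail.comp (by fun_prop) fun s hs => ?_
  exact ⟨mul_nonneg ht.1 hs.1, (mul_le_of_le_one_right ht.1 hs.2).trans_lt ht.2⟩

/-- For `t ≥ 1/2` one divides the identity `mul_integral_inv_tail` by `t`; for smaller `t` the
integrand is at most `1 / tail ω (1/2)`. -/
lemma IsRadialWeight.integral_inv_tail_mul_le {ω : ℝ → ℝ} (hω : IsRadialWeight ω)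
    {t : ℝ} (ht : t ∈ Ico (0 : ℝ) 1) :
    ∫ s in (0 : ℝ)..1, 1 / tail ω (t * s) ≤ (2 + 1 / tail ω (1 / 2)) * tailWeight ω t := by
  have hhalf : (1 / 2 : ℝ) ∈ Ico (0 : ℝ) 1 := by constructor <;> norm_num
  have hp := hω.tail_pos _ hhalf
  have hW := hω.one_le_tailWeight ht
  rcases le_or_gt (1 / 2) t with h | h
  · have h1 := mul_integral_inv_tail ω t
    have h2 : 0 ≤ ∫ s in (0 : ℝ)..1, 1 / tail ω (t * s) := by
      refine intervalIntegral.integral_nonneg zero_le_one fun s hs => ?_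
      exact one_div_nonneg.2 (hω.tail_pos _ ⟨mul_nonneg ht.1 hs.1,
        (mul_le_of_le_one_right ht.1 hs.2).trans_lt ht.2⟩).le
    have h3 : 0 ≤ 1 / tail ω (1 / 2) * tailWeight ω t := by positivity
    nlinarith
  · have h1 : ∫ s in (0 : ℝ)..1, 1 / tail ω (t * s) ≤ ∫ s in (0 : ℝ)..1, 1 / tail ω (1 / 2) := by
      refine intervalIntegral.integral_mono_on zero_le_one
        (hω.intervalIntegrable_inv_tail_mul ht) intervalIntegrable_const fun s hs => ?_
      refine one_div_le_one_div_of_le hp (hω.tail_anti (mul_nonneg ht.1 hs.1) ?_ (by norm_num))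
      exact (mul_le_of_le_one_right ht.1 hs.2).trans h.le
    simp only [intervalIntegral.integral_const, sub_zero, one_smul] at h1
    have : 1 / tail ω (1 / 2) * 1 ≤ 1 / tail ω (1 / 2) * tailWeight ω t := by gcongr
    linarith

/-- With `I` the integral, `tailWeight ω t = 1 + t I`; the `1` is absorbed because the integrand is
at least `1 / tail ω 0`. -/
lemma IsRadialWeight.tailWeight_le_integral_inv_tail_mul {ω : ℝ → ℝ} (hω : IsRadialWeight ω)
    {t : ℝ} (ht : t ∈ Ico (0 : ℝ) 1) :
    tailWeight ω t ≤ (tail ω 0 + 1) * ∫ s in (0 : ℝ)..1, 1 / tail ω (t * s) := by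
  have h0 := hω.tail_pos 0 (by simp)
  have h1 := mul_integral_inv_tail ω t
  have h2 : ∫ s in (0 : ℝ)..1, 1 / tail ω 0 ≤ ∫ s in (0 : ℝ)..1, 1 / tail ω (t * s) := by
    refine intervalIntegral.integral_mono_on zero_le_one intervalIntegrable_const
      (hω.intervalIntegrable_inv_tail_mul ht) fun s hs => ?_
    have hts : t * s < 1 := (mul_le_of_le_one_right ht.1 hs.2).trans_lt ht.2
    exact one_div_le_one_div_of_le (hω.tail_pos _ ⟨mul_nonneg ht.1 hs.1, hts⟩)
      (hω.tail_anti le_rfl (mul_nonneg ht.1 hs.1) hts.le)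
  simp only [intervalIntegral.integral_const, sub_zero, one_smul] at h2
  set I := ∫ s in (0 : ℝ)..1, 1 / tail ω (t * s)
  have h3 : 1 ≤ tail ω 0 * I := by
    have := mul_le_mul_of_nonneg_left h2 h0.le
    rwa [mul_one_div_cancel h0.ne'] at this
  have h4 : 0 ≤ I := le_trans (by positivity) h2
  nlinarith [ht.2]

/-- For `a ≥ 1/2`, already the part of the integral over `[2a-1, a]`, of length `1 - a`, is large
enough: the tail there is at most `C * tail ω a`, as `a` is the midpoint of `2a-1` and `1`. -/
lemma exists_div_tail_le_tailWeight {ω : ℝ → ℝ} (hω : IsRadialWeight ω) {C : ℝ} (hC : 1 ≤ C)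
    (hd : ∀ r ∈ Ico (0 : ℝ) 1, tail ω r ≤ C * tail ω ((1 + r) / 2)) :
    ∃ D : ℝ, 0 < D ∧ ∀ a ∈ Ico (0 : ℝ) 1, 1 - a ≤ D * tailWeight ω a * tail ω a := by
  have hhalf : (1 / 2 : ℝ) ∈ Ico (0 : ℝ) 1 := by constructor <;> norm_num
  have hp := hω.tail_pos _ hhalf
  refine ⟨C + 1 / tail ω (1 / 2), by positivity, fun a ha => ?_⟩
  have hta := hω.tail_pos a ha
  have hW := hω.one_le_tailWeight ha
  have hWt : 0 ≤ tailWeight ω a * tail ω a := by positivity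
  rw [mul_assoc, add_mul]
  rcases le_or_gt (1 / 2) a with h | h
  · have hr : 2 * a - 1 ∈ Ico (0 : ℝ) 1 := by constructor <;> linarith [ha.2]
    have h1 := hd _ hr
    rw [show (1 + (2 * a - 1)) / 2 = a by ring] at h1
    have h2 := hω.div_tail_le_integral hr.1 (by linarith [ha.2] : 2 * a - 1 ≤ a) ha.2
    have h3 := hω.tailWeight_sub hr ha
    have h4 := hω.one_le_tailWeight hr
    have htr := hω.tail_pos _ hr
    rw [← h3, div_le_iff₀ htr] at h2
    have h5 : 1 - a ≤ tailWeight ω a * tail ω (2 * a - 1) := by nlinarith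
    have h6 : tailWeight ω a * tail ω (2 * a - 1) ≤ tailWeight ω a * (C * tail ω a) := by gcongr
    have h7 : 0 ≤ 1 / tail ω (1 / 2) * (tailWeight ω a * tail ω a) := by positivity
    linarith
  · have h1 := hω.tail_anti ha.1 h.le (by norm_num)
    have h2 : 1 ≤ 1 / tail ω (1 / 2) * (tailWeight ω a * tail ω a) := by
      rw [one_div_mul_eq_div, one_le_div hp]
      nlinarith
    have h3 : 0 ≤ C * (tailWeight ω a * tail ω a) := by positivity
    linarith [ha.1]

/-- The increment from `a` to `(1+a)/2` is at most half of `1 - a` over the tail at the right end;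
doubling moves that tail to `a`, and `exists_div_tail_le_tailWeight` concludes. -/
lemma exists_tailWeight_le {ω : ℝ → ℝ} (hω : IsRadialWeight ω) {C : ℝ} (hC : 1 ≤ C)
    (hd : ∀ r ∈ Ico (0 : ℝ) 1, tail ω r ≤ C * tail ω ((1 + r) / 2)) :
    ∃ E : ℝ, 1 ≤ E ∧ ∀ a ∈ Ico (0 : ℝ) 1, tailWeight ω ((1 + a) / 2) ≤ E * tailWeight ω a := by
  obtain ⟨D, hD, h⟩ := exists_div_tail_le_tailWeight hω hC hd
  refine ⟨1 + C * D, by nlinarith, fun a ha => ?_⟩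
  have hb : (1 + a) / 2 ∈ Ico (0 : ℝ) 1 := by constructor <;> linarith [ha.1, ha.2]
  have hab : a ≤ (1 + a) / 2 := by linarith [ha.2]
  have htb := hω.tail_pos _ hb
  have h1 := hω.tailWeight_sub ha hb
  have h2 := hω.integral_le_div_tail ha.1 hab hb.2
  have hW := hω.one_le_tailWeight ha
  have h3 : ((1 + a) / 2 - a) / tail ω ((1 + a) / 2) ≤ C * D * tailWeight ω a := by
    rw [div_le_iff₀ htb]
    have h4 : D * tailWeight ω a * tail ω a ≤
        D * tailWeight ω a * (C * tail ω ((1 + a) / 2)) := by gcongr; exact hd a ha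
    have := h a ha
    nlinarith [ha.2]
  linarith

lemma exists_avgCoeff_mul_pow_le {ω : ℝ → ℝ} (hω : IsRadialWeight ω) {C : ℝ} (hC : 1 ≤ C)
    (hd : ∀ r ∈ Ico (0 : ℝ) 1, tail ω r ≤ C * tail ω ((1 + r) / 2)) :
    ∃ D : ℝ, 0 < D ∧ ∀ s ∈ Ico (0 : ℝ) 1, ∀ n, avgCoeff ω n * s ^ n ≤ D * tailWeight ω s := by
  obtain ⟨D, hD, h⟩ := exists_div_tail_le_tailWeight hω hC hd
  obtain ⟨E, hE, hWE⟩ := exists_tailWeight_le hω hC hd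
  refine ⟨4 * D * E, by positivity, fun s hs n => ?_⟩
  have hm := hω.moment_pos (2 * n + 1)
  have hW := hω.one_le_tailWeight hs
  have hs0 := hs.1
  have hn : (0 : ℝ) < (n : ℝ) + 1 := by positivity
  have key : s ^ n ≤ 4 * D * E * tailWeight ω s * (2 * moment ω (2 * n + 1) * (n + 1)) := by
    -- If `n + 1 ≤ 1/(1-s)`, then `s^n ≤ 1` suffices and the moment is compared with the tail at
    -- scale `1/n`. Otherwise the decay of `s^n` is used at scale `1 - s`.
    rcases le_or_gt (((n : ℝ) + 1) * (1 - s)) 1 with h1 | h1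
    · have hu0 := one_sub_one_div_mem n
      set u₀ := 1 - 1 / ((n : ℝ) + 1) with hu₀
      have hu0s : u₀ ≤ s := by
        have : 1 - s ≤ 1 / ((n : ℝ) + 1) := by rw [le_div_iff₀ hn]; linarith
        linarith
      have hu := one_sub_one_div_mem (2 * n + 1)
      have hmt := hω.tail_le_moment (2 * n + 1)
      -- The point `1 - 1/(2n+2)` attached to the moment of order `2n+1` is the midpoint of `u₀` and
      -- `1`, so one doubling of `tailWeight` returns to `u₀ ≤ s`.
      have hueq : 1 - 1 / (((2 * n + 1 : ℕ) : ℝ) + 1) = (1 + u₀) / 2 := by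
        rw [hu₀]; push_cast; field_simp; ring
      rw [hueq] at hu hmt
      have h2 := h _ hu
      have h3 := (hWE _ hu0).trans (mul_le_mul_of_nonneg_left
        (hω.tailWeight_mono hu0.1 hu0s hs.2) (by linarith))
      have h4 : (1 - (1 + u₀) / 2) * (2 * (n + 1)) = 1 := by rw [hu₀]; field_simp; ring
      have ht := hω.tail_pos _ hu
      have h5 : 1 - (1 + u₀) / 2 ≤ D * (E * tailWeight ω s) * (4 * moment ω (2 * n + 1)) :=
        h2.trans (by gcongr)
      have h6 := mul_le_mul_of_nonneg_right h5 (by positivity : 0 ≤ 2 * ((n : ℝ) + 1))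
      rw [h4] at h6
      calc s ^ n ≤ 1 := pow_le_one₀ hs0 hs.2.le
        _ ≤ _ := h6
        _ = _ := by ring
    · have hu : (1 + s) / 2 ∈ Ico (0 : ℝ) 1 := by constructor <;> linarith [hs.2]
      set u := (1 + s) / 2 with hudef
      have h2 := hω.pow_mul_tail_le_moment hu (2 * n + 1)
      have h3 : s ^ n * (1 / 2) ≤ u ^ (2 * n + 1) := by
        rw [pow_succ, pow_mul]
        have hsu : s ≤ u ^ 2 := by rw [hudef]; nlinarith [sq_nonneg (1 - s)]
        have : (1 : ℝ) / 2 ≤ u := by linarith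
        gcongr
      have ht := hω.tail_pos _ hu
      have h4 : (1 - s) / 2 ≤ D * (E * tailWeight ω s) * tail ω u := by
        have := h _ hu
        have h5 : 1 - u = (1 - s) / 2 := by rw [hudef]; ring
        rw [h5] at this
        exact this.trans (by gcongr; exact hWE s hs)
      have hsn : 0 ≤ s ^ n := by positivity
      have h6 : s ^ n * (1 / 2) * tail ω u ≤ moment ω (2 * n + 1) :=
        (mul_le_mul_of_nonneg_right h3 ht.le).trans h2
      calc s ^ n = s ^ n * 1 := by ring
        _ ≤ s ^ n * ((n + 1) * (1 - s)) := by gcongr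
        _ ≤ s ^ n * ((n + 1) * (2 * (D * (E * tailWeight ω s) * tail ω u))) := by
            gcongr; linarith
        _ = 4 * D * E * tailWeight ω s * (n + 1) * (s ^ n * (1 / 2) * tail ω u) := by ring
        _ ≤ 4 * D * E * tailWeight ω s * (n + 1) * moment ω (2 * n + 1) := by gcongr
        _ ≤ _ := by
            have : 0 ≤ 4 * D * E * tailWeight ω s * (n + 1) * moment ω (2 * n + 1) := by
              positivity
            linarith
  rw [avgCoeff, kernelCoeff, div_div, one_div_mul_eq_div, div_le_iff₀ (by positivity)]
  exact key

/-- A difference of reciprocals of moments: `moment_sub_le` gains `1/(n+1)` at the price of the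
moment of order `n`, which doubling replaces by the one of order `2n+1`. -/
lemma exists_kernelDiff_le {ω : ℝ → ℝ} (hω : IsRadialWeight ω) {C : ℝ} (hC : 1 ≤ C)
    (hd : ∀ r ∈ Ico (0 : ℝ) 1, tail ω r ≤ C * tail ω ((1 + r) / 2)) :
    ∃ D : ℝ, 0 < D ∧ ∀ n, |kernelDiff ω n| ≤ D * avgCoeff ω n := by
  obtain ⟨K, hK, hKm⟩ := exists_moment_le_tail hω hC hd
  refine ⟨1 + 16 * K * C, by positivity, fun n => ?_⟩
  rcases n with _ | n
  · have := hω.kernelCoeff_pos 0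
    simp only [kernelDiff, avgCoeff, abs_of_pos this]
    have : 0 ≤ 16 * K * C * kernelCoeff ω 0 := by positivity
    simp; linarith
  have h1 := hω.moment_sub_le (n := n + 1) (by lia)
  rw [show 2 * (n + 1) - 1 = 2 * n + 1 by lia, Nat.add_sub_cancel] at h1
  have hm1 := hω.moment_pos (2 * n + 1)
  have hm2 := hω.moment_pos (2 * (n + 1) + 1)
  have h2 : moment ω n ≤ 4 * K * C * moment ω (2 * n + 1) := by
    have h3 := hd _ (one_sub_one_div_mem n)
    have h4 : (1 + (1 - 1 / ((n : ℝ) + 1))) / 2 = 1 - 1 / (((2 * n + 1 : ℕ) : ℝ) + 1) := by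
      push_cast; field_simp; ring
    rw [h4] at h3
    calc moment ω n ≤ K * tail ω (1 - 1 / ((n : ℝ) + 1)) := hKm n
      _ ≤ K * (C * (4 * moment ω (2 * n + 1))) := by
          gcongr
          exact h3.trans (by gcongr; exact hω.tail_le_moment _)
      _ = _ := by ring
  have h5 : moment ω (2 * n + 1) - moment ω (2 * (n + 1) + 1) ≤
      2 / ((n + 1 : ℕ) : ℝ) * (4 * K * C * moment ω (2 * n + 1)) :=
    h1.trans (by gcongr)
  have hmono : moment ω (2 * (n + 1) + 1) ≤ moment ω (2 * n + 1) := hω.moment_antitone (by lia)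
  have heq : kernelDiff ω (n + 1) = (moment ω (2 * n + 1) - moment ω (2 * (n + 1) + 1)) /
      (2 * moment ω (2 * n + 1) * moment ω (2 * (n + 1) + 1)) := by
    simp only [kernelDiff, kernelCoeff]
    field_simp
  have hnn : 0 ≤ kernelDiff ω (n + 1) := by
    rw [heq]; apply div_nonneg <;> [linarith; positivity]
  rw [abs_of_nonneg hnn, heq, div_le_iff₀ (by positivity)]
  refine h5.trans ?_
  simp only [avgCoeff, kernelCoeff]
  push_cast
  have h6 : (1 + 16 * K * C) * (1 / (2 * moment ω (2 * (n + 1) + 1)) / ((n : ℝ) + 1 + 1)) *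
      (2 * moment ω (2 * n + 1) * moment ω (2 * (n + 1) + 1)) =
      (1 + 16 * K * C) * moment ω (2 * n + 1) / ((n : ℝ) + 1 + 1) := by field_simp
  rw [h6, div_mul_eq_mul_div, div_le_div_iff₀ (by positivity) (by positivity)]
  have h7 : 0 ≤ K * C * moment ω (2 * n + 1) := by positivity
  have h8 : 0 ≤ K * C * moment ω (2 * n + 1) * n := by positivity
  nlinarith

/-- With `v = (1+s)/2`, use `s^n ≤ v^n · v^n`: one factor is spent on bounding `avgCoeff`, the other
survives as geometric decay, so that Parseval's series sums to `O(1/(1-s))`. -/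
lemma exists_kernelDiff_sq_le {ω : ℝ → ℝ} (hω : IsRadialWeight ω) {C : ℝ} (hC : 1 ≤ C)
    (hd : ∀ r ∈ Ico (0 : ℝ) 1, tail ω r ≤ C * tail ω ((1 + r) / 2)) :
    ∃ D : ℝ, 0 < D ∧ ∀ s ∈ Ico (0 : ℝ) 1, ∀ n,
      |kernelDiff ω n| ^ 2 * s ^ (2 * n) ≤ D * tailWeight ω s ^ 2 * ((1 + s) / 2) ^ n := by
  obtain ⟨D, hD, h1⟩ := exists_kernelDiff_le hω hC hd
  obtain ⟨B, hB, h2⟩ := exists_avgCoeff_mul_pow_le hω hC hd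
  obtain ⟨E, hE, h3⟩ := exists_tailWeight_le hω hC hd
  refine ⟨(D * B * E) ^ 2, by positivity, fun s hs n => ?_⟩
  have hv : (1 + s) / 2 ∈ Ico (0 : ℝ) 1 := by constructor <;> linarith [hs.1, hs.2]
  set v := (1 + s) / 2 with hvdef
  have hv0 := hv.1
  have hs0 := hs.1
  have hsv : s ≤ v ^ 2 := by rw [hvdef]; nlinarith [sq_nonneg (1 - s)]
  have hW := hω.one_le_tailWeight hs
  have hc0 := hω.avgCoeff_nonneg n
  have h4 : |kernelDiff ω n| * s ^ n ≤ D * B * E * tailWeight ω s * v ^ n := by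
    calc |kernelDiff ω n| * s ^ n ≤ D * avgCoeff ω n * (v ^ 2) ^ n := by
          gcongr; exact h1 n
      _ = D * (avgCoeff ω n * v ^ n) * v ^ n := by rw [← pow_mul, two_mul, pow_add]; ring
      _ ≤ D * (B * (E * tailWeight ω s)) * v ^ n := by
          have h5 : avgCoeff ω n * v ^ n ≤ B * (E * tailWeight ω s) :=
            (h2 v hv n).trans (mul_le_mul_of_nonneg_left (h3 s hs) hB.le)
          exact mul_le_mul_of_nonneg_right (mul_le_mul_of_nonneg_left h5 hD.le) (pow_nonneg hv0 n)
      _ = _ := by ring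
  calc |kernelDiff ω n| ^ 2 * s ^ (2 * n) = (|kernelDiff ω n| * s ^ n) ^ 2 := by
        rw [mul_pow, ← pow_mul, mul_comm 2]
    _ ≤ (D * B * E * tailWeight ω s * v ^ n) ^ 2 := by gcongr
    _ = (D * B * E) ^ 2 * tailWeight ω s ^ 2 * (v ^ n * v ^ n) := by ring
    _ ≤ (D * B * E) ^ 2 * tailWeight ω s ^ 2 * (v ^ n * 1) := by
        gcongr; exact pow_le_one₀ hv0 hv.2.le
    _ = _ := by ring

/-- A lower bound for the averaged kernel on the radius. -/
lemma exists_div_tail_le_tsum {ω : ℝ → ℝ} (hω : IsRadialWeight ω) {C : ℝ} (hC : 1 ≤ C)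
    (hd : ∀ r ∈ Ico (0 : ℝ) 1, tail ω r ≤ C * tail ω ((1 + r) / 2)) :
    ∃ c : ℝ, 0 < c ∧ ∀ y ∈ Ico (0 : ℝ) 1, c / tail ω y ≤ ∑' n, avgCoeff ω n * y ^ n := by
  obtain ⟨K, hK, hKm⟩ := exists_moment_le_tail hω hC hd
  have hhalf : (1 / 2 : ℝ) ∈ Ico (0 : ℝ) 1 := by constructor <;> norm_num
  have hp := hω.tail_pos _ hhalf
  have hc0 : 0 < avgCoeff ω 0 := by
    have := hω.kernelCoeff_pos 0
    unfold avgCoeff; positivity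
  refine ⟨min (1 / (256 * K)) (tail ω (1 / 2) * avgCoeff ω 0), by positivity, fun y hy => ?_⟩
  have hy0 := hy.1
  have hty := hω.tail_pos y hy
  have hnn : ∀ n, 0 ≤ avgCoeff ω n * y ^ n := fun n =>
    mul_nonneg (hω.avgCoeff_nonneg n) (pow_nonneg hy0 n)
  have hs := hω.summable_avgCoeff hy.1 hy.2
  -- For small `y` the constant term is enough. Otherwise the block `N ≤ n < 2N` with `N` about
  -- `1/(1-y)` is: there `y^n` is bounded below, and the `N` terms compensate the factor `1/(n+1)`
  -- in `avgCoeff`.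
  rcases lt_or_ge y (1 / 2) with h | h
  · have h1 : avgCoeff ω 0 ≤ ∑' n, avgCoeff ω n * y ^ n := by
      simpa using hs.le_tsum 0 fun n _ => hnn n
    refine le_trans ?_ h1
    rw [div_le_iff₀ hty]
    refine (min_le_right _ _).trans ?_
    rw [mul_comm]
    gcongr
    exact hω.tail_anti hy.1 h.le (by norm_num)
  · have hy1 : 0 < 1 - y := by linarith [hy.2]
    set N := ⌊1 / (1 - y)⌋₊ with hN
    have hN1 : (N : ℝ) ≤ 1 / (1 - y) := Nat.floor_le (by positivity)
    have hN2 : 1 / (1 - y) < N + 1 := Nat.lt_floor_add_one _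
    have hN3 : 2 ≤ N := by
      refine Nat.le_floor ?_
      rw [le_div_iff₀ hy1]; push_cast; linarith
    have hNpos : (0 : ℝ) < N := by positivity
    have hyN : 1 - 1 / (N : ℝ) ≤ y := by
      have : 1 - y ≤ 1 / N := by
        rw [le_div_iff₀ hNpos, mul_comm]; rwa [le_div_iff₀ hy1] at hN1
      linarith
    have hyp : (1 / 8 : ℝ) ≤ y ^ N := by
      have h1 := quarter_le_pow (N - 1)
      have h2 : ((N - 1 : ℕ) : ℝ) + 1 = N := by
        rw [Nat.cast_sub (by lia)]; push_cast; ring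
      rw [h2] at h1
      have h3 : 0 ≤ 1 - 1 / (N : ℝ) := by
        rw [sub_nonneg, div_le_one hNpos]; exact_mod_cast (by lia : 1 ≤ N)
      calc (1 / 8 : ℝ) = 1 / 4 * (1 / 2) := by norm_num
        _ ≤ y ^ (N - 1) * y := by
            gcongr
            exact h1.trans (by gcongr)
        _ = y ^ N := by rw [← pow_succ]; congr 1; lia
    have hmN := hω.moment_pos (2 * N + 1)
    have hmle : moment ω (2 * N + 1) ≤ K * tail ω y := by
      refine (hKm _).trans ?_
      gcongr
      have hmem := one_sub_one_div_mem (2 * N + 1)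
      refine hω.tail_anti hy0 ?_ hmem.2.le
      have h1 : 1 / (((2 * N + 1 : ℕ) : ℝ) + 1) ≤ 1 - y := by
        rw [div_le_iff₀ (by positivity)]
        rw [div_lt_iff₀ hy1] at hN2
        push_cast
        nlinarith
      linarith
    have hterm : ∀ n ∈ Finset.Ico N (2 * N),
        1 / (256 * N * moment ω (2 * N + 1)) ≤ avgCoeff ω n * y ^ n := by
      intro n hn
      rw [Finset.mem_Ico] at hn
      have hmn := hω.moment_pos (2 * n + 1)
      have h1 : moment ω (2 * n + 1) ≤ moment ω (2 * N + 1) := hω.moment_antitone (by lia)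
      have h2 : ((n : ℝ) + 1) ≤ 2 * N := by exact_mod_cast (by lia : n + 1 ≤ 2 * N)
      have h3 : 1 / (2 * moment ω (2 * N + 1)) / (2 * N) ≤ avgCoeff ω n := by
        unfold avgCoeff kernelCoeff
        gcongr
      have h4 : (1 / 64 : ℝ) ≤ y ^ n := by
        calc (1 / 64 : ℝ) = 1 / 8 * (1 / 8) := by norm_num
          _ ≤ y ^ N * y ^ N := by gcongr
          _ = y ^ (2 * N) := by rw [two_mul, pow_add]
          _ ≤ y ^ n := pow_le_pow_of_le_one hy0 hy.2.le hn.2.le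
      calc 1 / (256 * N * moment ω (2 * N + 1))
          = 1 / (2 * moment ω (2 * N + 1)) / (2 * N) * (1 / 64) := by field_simp; norm_num
        _ ≤ _ := mul_le_mul h3 h4 (by norm_num) (hω.avgCoeff_nonneg n)
    have hsum := hs.sum_le_tsum (Finset.Ico N (2 * N)) fun n _ => hnn n
    have hsum2 := Finset.card_nsmul_le_sum _ _ _ hterm
    rw [Nat.card_Ico, nsmul_eq_mul, show 2 * N - N = N by lia] at hsum2
    refine le_trans ?_ (hsum2.trans hsum)
    rw [div_le_iff₀ hty]
    refine (min_le_left _ _).trans ?_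
    have h5 : (N : ℝ) * (1 / (256 * N * moment ω (2 * N + 1))) * tail ω y =
        tail ω y / (256 * moment ω (2 * N + 1)) := by field_simp
    rw [h5, div_le_div_iff₀ (by positivity) (by positivity)]
    linarith

/-! ### The kernels as power series -/

lemma differentiableOn_disc_tsum {a : ℕ → ℂ}
    (ha : ∀ ρ ∈ Ico (0 : ℝ) 1, Summable fun n => ‖a n‖ * ρ ^ n) :
    DifferentiableOn ℂ (fun z => ∑' n, a n * z ^ n) disc := by
  intro z hz
  have hz1 : ‖z‖ < 1 := by simpa [disc] using hz
  set ρ := (1 + ‖z‖) / 2 with hρ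
  have hρ01 : ρ ∈ Ico (0 : ℝ) 1 := by constructor <;> linarith [norm_nonneg z]
  have h := Complex.differentiableOn_tsum_of_summable_norm (ha ρ hρ01)
    (F := fun n z => a n * z ^ n) (U := Metric.ball 0 ρ) (fun n => by fun_prop) Metric.isOpen_ball
    fun n w hw => by
      rw [mem_ball_zero_iff] at hw
      rw [norm_mul, norm_pow]
      gcongr
  refine (h.differentiableAt (Metric.isOpen_ball.mem_nhds ?_)).differentiableWithinAt
  rw [mem_ball_zero_iff]
  linarith

/-- The power series of the Bergman kernel: `B^ω_t(z) = kernelFun ω (t z)`. -/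
def kernelFun (ω : ℝ → ℝ) (w : ℂ) : ℂ := ∑' n, (kernelCoeff ω n : ℂ) * w ^ n

/-- The power series of the averaged kernel: `K^ω_t(z) = avgKernelFun ω (t z)`. -/
def avgKernelFun (ω : ℝ → ℝ) (w : ℂ) : ℂ := ∑' n, (avgCoeff ω n : ℂ) * w ^ n

lemma mul_mem_disc {t : ℝ} (ht : t ∈ Icc (0 : ℝ) 1) {z : ℂ} (hz : z ∈ disc) :
    (t : ℂ) * z ∈ disc := by
  have hz1 : ‖z‖ < 1 := by simpa [disc] using hz
  simp only [disc, mem_ball_zero_iff, norm_mul, Complex.norm_real, Real.norm_eq_abs,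
    abs_of_nonneg ht.1]
  exact (mul_le_of_le_one_left (norm_nonneg z) ht.2).trans_lt hz1

namespace IsRadialWeight

lemma summable_norm_kernelCoeff {ω : ℝ → ℝ} (hω : IsRadialWeight ω)
    {ρ : ℝ} (hρ : ρ ∈ Ico (0 : ℝ) 1) :
    Summable fun n => ‖(kernelCoeff ω n : ℂ)‖ * ρ ^ n := by
  simpa [abs_of_pos (hω.kernelCoeff_pos _)] using hω.summable_kernelCoeff hρ.1 hρ.2

lemma summable_norm_avgCoeff {ω : ℝ → ℝ} (hω : IsRadialWeight ω) {ρ : ℝ} (hρ : ρ ∈ Ico (0 : ℝ) 1) :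
    Summable fun n => ‖(avgCoeff ω n : ℂ)‖ * ρ ^ n := by
  simpa [abs_of_nonneg (hω.avgCoeff_nonneg _)] using hω.summable_avgCoeff hρ.1 hρ.2

lemma hasSum_kernelFun {ω : ℝ → ℝ} (hω : IsRadialWeight ω) {w : ℂ} (hw : w ∈ disc) :
    HasSum (fun n => (kernelCoeff ω n : ℂ) * w ^ n) (kernelFun ω w) := by
  have hw1 : ‖w‖ < 1 := by simpa [disc] using hw
  refine Summable.hasSum (Summable.of_norm ?_)
  simpa using hω.summable_norm_kernelCoeff ⟨norm_nonneg w, hw1⟩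

lemma hasSum_avgKernelFun {ω : ℝ → ℝ} (hω : IsRadialWeight ω) {w : ℂ} (hw : w ∈ disc) :
    HasSum (fun n => (avgCoeff ω n : ℂ) * w ^ n) (avgKernelFun ω w) := by
  have hw1 : ‖w‖ < 1 := by simpa [disc] using hw
  refine Summable.hasSum (Summable.of_norm ?_)
  simpa using hω.summable_norm_avgCoeff ⟨norm_nonneg w, hw1⟩

lemma differentiableOn_kernelFun {ω : ℝ → ℝ} (hω : IsRadialWeight ω)
    : DifferentiableOn ℂ (kernelFun ω) disc :=
  differentiableOn_disc_tsum fun _ => hω.summable_norm_kernelCoeff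

lemma differentiableOn_avgKernelFun {ω : ℝ → ℝ} (hω : IsRadialWeight ω)
    : DifferentiableOn ℂ (avgKernelFun ω) disc :=
  differentiableOn_disc_tsum fun _ => hω.summable_norm_avgCoeff

lemma bergmanKernel_eq {ω : ℝ → ℝ} (hω : IsRadialWeight ω)
    {t : ℝ} (ht : t ∈ Ico (0 : ℝ) 1) {z : ℂ} (hz : z ∈ disc) :
    bergmanKernel ω t z = kernelFun ω (t * z) :=
  (hω.hasSum_bergmanKernel ht hz).unique
    (hω.hasSum_kernelFun (mul_mem_disc (Ico_subset_Icc_self ht) hz))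

lemma integral_kernelFun {ω : ℝ → ℝ} (hω : IsRadialWeight ω) {w : ℂ} (hw : w ∈ disc) :
    ∫ s in (0 : ℝ)..1, kernelFun ω (s * w) = avgKernelFun ω w := by
  have hw1 : ‖w‖ < 1 := by simpa [disc] using hw
  have hs := hω.summable_norm_kernelCoeff ⟨norm_nonneg w, hw1⟩
  have h := intervalIntegral.hasSum_integral_of_dominated_convergence (μ := volume)
    (a := 0) (b := 1)
    (F := fun n (s : ℝ) => (kernelCoeff ω n : ℂ) * (s * w) ^ n)
    (f := fun s : ℝ => kernelFun ω (s * w))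
    (fun n _ => ‖(kernelCoeff ω n : ℂ)‖ * ‖w‖ ^ n)
    (fun n => (by fun_prop : Continuous _).aestronglyMeasurable)
    (fun n => Eventually.of_forall fun s hs => ?_) (Eventually.of_forall fun s _ => hs)
    intervalIntegrable_const (Eventually.of_forall fun s hs => ?_)
  · refine h.unique ?_
    have he : (fun n => ∫ s in (0 : ℝ)..1, (kernelCoeff ω n : ℂ) * (s * w) ^ n) =
        fun n => (avgCoeff ω n : ℂ) * w ^ n := by
      ext n
      have : ∀ s : ℝ, (kernelCoeff ω n : ℂ) * (s * w) ^ n =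
          (kernelCoeff ω n : ℂ) * w ^ n * ((s ^ n : ℝ) : ℂ) := fun s => by push_cast; ring
      simp_rw [this]
      rw [intervalIntegral.integral_const_mul, intervalIntegral.integral_ofReal, integral_pow,
        avgCoeff]
      push_cast
      simp
      ring
    rw [he]
    exact hω.hasSum_avgKernelFun hw
  · rw [uIoc_of_le zero_le_one] at hs
    simp only [norm_mul, norm_pow, Complex.norm_real, Real.norm_of_nonneg hs.1.le]
    have h0 := hs.1.le
    gcongr
    exact mul_le_of_le_one_left (norm_nonneg w) hs.2
  · rw [uIoc_of_le zero_le_one] at hs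
    exact hω.hasSum_kernelFun (mul_mem_disc (Ioc_subset_Icc_self hs) hw)

lemma averagedKernel_eq {ω : ℝ → ℝ} (hω : IsRadialWeight ω)
    {t : ℝ} (ht : t ∈ Ico (0 : ℝ) 1) {z : ℂ} (hz : z ∈ disc) :
    averagedKernel ω t z = avgKernelFun ω (t * z) := by
  have htz := mul_mem_disc (Ico_subset_Icc_self ht) hz
  rw [← hω.integral_kernelFun htz, averagedKernel]
  split_ifs with h
  · subst h
    rw [hω.bergmanKernel_eq ht hz]
    simp
  · rw [intervalIntegral.integral_mul_const, one_div, mul_comm _ z, inv_mul_cancel_left₀ h]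
    refine intervalIntegral.integral_congr fun s hs => ?_
    rw [uIcc_of_le zero_le_one] at hs
    rw [hω.bergmanKernel_eq ht (mul_mem_disc hs hz)]
    congr 1; ring

lemma hasSum_one_sub_mul_kernelFun {ω : ℝ → ℝ} (hω : IsRadialWeight ω) {w : ℂ} (hw : w ∈ disc) :
    HasSum (fun n => (kernelDiff ω n : ℂ) * w ^ n) ((1 - w) * kernelFun ω w) := by
  have h := hω.hasSum_kernelFun hw
  have h1 := (hasSum_nat_add_iff' 1).2 h
  have h2 := h1.sub (h.mul_left w)
  rw [← hasSum_nat_add_iff' 1]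
  convert h2 using 1
  · ext n
    simp only [kernelDiff]
    push_cast
    ring
  · simp [kernelDiff]
    ring

end IsRadialWeight

/-- Cauchy–Schwarz for the factors `(1 - z) * kernelFun ω z` and `(1 - z)⁻¹`. Both quadratic means
come from Parseval, of orders `W² / (1-σ)` and `1 / (1-σ)`. -/
lemma exists_circleAverage_kernelFun_le {ω : ℝ → ℝ} (hω : IsRadialWeight ω) {C : ℝ} (hC : 1 ≤ C)
    (hd : ∀ r ∈ Ico (0 : ℝ) 1, tail ω r ≤ C * tail ω ((1 + r) / 2)) :
    ∃ D : ℝ, 0 < D ∧ ∀ σ ∈ Ico (0 : ℝ) 1,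
      circleAverage (fun z => ‖kernelFun ω z‖) 0 σ ≤ D * tailWeight ω σ / (1 - σ) := by
  obtain ⟨D, hD, h⟩ := exists_kernelDiff_sq_le hω hC hd
  refine ⟨D + 1, by positivity, fun σ hσ => ?_⟩
  have hσ0 := hσ.1
  have hσ1 : 0 < 1 - σ := by linarith [hσ.2]
  have hin : ∀ z : ℂ, ‖z‖ = σ → z ∈ disc := fun z hz => by simp [disc, hz, hσ.2]
  have hW := hω.one_le_tailWeight hσ
  set W := tailWeight ω σ with hWdef
  have hW0 : 0 < W := by linarith
  have hne : ∀ z : ℂ, ‖z‖ = σ → 1 - z ≠ 0 := fun z hz h0 => by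
    have : z = 1 := (sub_eq_zero.1 h0).symm
    rw [this, norm_one] at hz
    linarith
  have hs1 : Summable fun n => ‖(kernelDiff ω n : ℂ)‖ * σ ^ n := by
    have h1 := (hω.hasSum_one_sub_mul_kernelFun (w := (σ : ℂ))
      (hin _ (by simp [abs_of_nonneg hσ0]))).summable.norm
    simpa [abs_of_nonneg hσ0] using h1
  have hP1 := hasSum_circleAverage_norm_sq hσ0 hs1
    (fun z hz => hω.hasSum_one_sub_mul_kernelFun (hin z hz))
  have hs2 : Summable fun n : ℕ => ‖(1 : ℂ)‖ * σ ^ n := by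
    simpa using summable_geometric_of_lt_one hσ0 hσ.2
  have hP2 := hasSum_circleAverage_norm_sq (a := fun _ => 1) (F := fun z => (1 - z)⁻¹) hσ0 hs2
    (fun z hz => by simpa using hasSum_geometric_of_norm_lt_one (by rw [hz]; exact hσ.2))
  have hI1 : circleAverage (fun z => ‖(1 - z) * kernelFun ω z‖ ^ 2) 0 σ ≤
      D * W ^ 2 * (2 / (1 - σ)) := by
    have hgeo := (hasSum_geometric_of_lt_one (r := (1 + σ) / 2) (by linarith)
      (by linarith)).mul_left (D * W ^ 2)
    rw [show (1 - (1 + σ) / 2)⁻¹ = 2 / (1 - σ) by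
      rw [show 1 - (1 + σ) / 2 = (1 - σ) / 2 by ring, inv_div]] at hgeo
    refine hasSum_le (fun n => ?_) hP1 hgeo
    rw [Complex.norm_real, Real.norm_eq_abs]
    exact h σ hσ n
  have hI2 : circleAverage (fun z : ℂ => ‖(1 - z)⁻¹‖ ^ 2) 0 σ ≤ 1 / (1 - σ) := by
    have hgeo := hasSum_geometric_of_lt_one hσ0 hσ.2
    rw [one_div]
    refine hasSum_le (fun n => ?_) hP2 hgeo
    simp only [norm_one, one_pow, one_mul]
    exact pow_le_pow_of_le_one hσ0 hσ.2.le (by lia)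
  have hkc : ContinuousOn (kernelFun ω) (Metric.sphere 0 σ) :=
    hω.differentiableOn_kernelFun.continuousOn.mono fun z hz =>
      hin z (mem_sphere_zero_iff_norm.1 hz)
  have hc1 : ContinuousOn (fun z => ‖(1 - z) * kernelFun ω z‖ ^ 2) (Metric.sphere 0 σ) := by
    fun_prop
  have hc2 : ContinuousOn (fun z : ℂ => ‖(1 - z)⁻¹‖ ^ 2) (Metric.sphere 0 σ) := by
    refine (ContinuousOn.inv₀ (by fun_prop) fun z hz => ?_).norm.pow 2
    exact hne z (mem_sphere_zero_iff_norm.1 hz)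
  have hc1' : ContinuousOn (fun z => (1 / (2 * W)) • ‖(1 - z) * kernelFun ω z‖ ^ 2)
    (Metric.sphere 0 σ) := by fun_prop
  have hc2' : ContinuousOn (fun z : ℂ => (W / 2) • ‖(1 - z)⁻¹‖ ^ 2) (Metric.sphere 0 σ) :=
    continuousOn_const.fun_smul hc2
  -- Cauchy–Schwarz in its arithmetic-geometric form; the weight `W` balances the two quadratic
  -- means.
  have hle : circleAverage (fun z => ‖kernelFun ω z‖) 0 σ ≤
      circleAverage (fun z => (1 / (2 * W)) • ‖(1 - z) * kernelFun ω z‖ ^ 2 +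
        (W / 2) • ‖(1 - z)⁻¹‖ ^ 2) 0 σ := by
    refine Real.circleAverage_mono (hkc.norm.circleIntegrable hσ0)
      ((hc1'.add hc2').circleIntegrable hσ0) fun z hz => ?_
    rw [mem_sphere_zero_iff_norm, abs_of_nonneg hσ0] at hz
    have hz0 : 0 < ‖1 - z‖ := norm_pos_iff.2 (hne z hz)
    simp only [smul_eq_mul, norm_mul, norm_inv]
    have : 1 / (2 * W) * (‖1 - z‖ * ‖kernelFun ω z‖) ^ 2 + W / 2 * ‖1 - z‖⁻¹ ^ 2 -
        ‖kernelFun ω z‖ = (‖1 - z‖ * ‖kernelFun ω z‖ - W * ‖1 - z‖⁻¹) ^ 2 / (2 * W) := by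
      field_simp
      ring
    have h2 : 0 ≤ (‖1 - z‖ * ‖kernelFun ω z‖ - W * ‖1 - z‖⁻¹) ^ 2 / (2 * W) := by positivity
    linarith
  refine hle.trans ?_
  rw [Real.circleAverage_fun_add (hc1'.circleIntegrable hσ0) (hc2'.circleIntegrable hσ0),
    Real.circleAverage_fun_smul, Real.circleAverage_fun_smul, smul_eq_mul, smul_eq_mul]
  calc _ ≤ 1 / (2 * W) * (D * W ^ 2 * (2 / (1 - σ))) + W / 2 * (1 / (1 - σ)) := by gcongr
    _ = (D + 1 / 2) * W / (1 - σ) := by field_simp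
    _ ≤ _ := by gcongr; norm_num

/-! ### Integral means -/

lemma ofReal_circleAverage_norm {F : ℂ → ℂ} {ρ : ℝ} (hρ : 0 ≤ ρ)
    (hF : ContinuousOn F (Metric.sphere 0 ρ)) :
    ENNReal.ofReal (circleAverage (fun z => ‖F z‖) 0 ρ) =
      ENNReal.ofReal (2 * Real.pi)⁻¹ *
        ∫⁻ θ in Ioc 0 (2 * Real.pi), ‖F (circleMap 0 ρ θ)‖ₑ := by
  have hc : Continuous fun θ => F (circleMap 0 ρ θ) :=
    hF.comp_continuous (continuous_circleMap 0 ρ) (circleMap_mem_sphere 0 hρ)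
  rw [Real.circleAverage_def, smul_eq_mul, ENNReal.ofReal_mul (by positivity),
    intervalIntegral.integral_of_le (by positivity),
    ofReal_integral_eq_lintegral_ofReal hc.norm.integrableOn_Ioc
      (Eventually.of_forall fun θ => norm_nonneg _)]
  simp_rw [ofReal_norm]

/-- Minkowski's integral inequality for integral means. -/
lemma ofReal_circleAverage_norm_integral_le {μ : Measure ℝ} [SFinite μ] {Φ : ℝ → ℂ → ℂ}
    {F : ℂ → ℂ} {ρ : ℝ} (hρ : 0 ≤ ρ) (hF : ContinuousOn F (Metric.sphere 0 ρ))
    (hΦ : ∀ᵐ s ∂μ, ContinuousOn (Φ s) (Metric.sphere 0 ρ))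
    (hm : AEStronglyMeasurable (fun p : ℝ × ℝ => Φ p.1 (circleMap 0 ρ p.2))
      (μ.prod (volume.restrict (Ioc 0 (2 * Real.pi)))))
    (hFΦ : ∀ z, ‖z‖ = ρ → F z = ∫ s, Φ s z ∂μ) :
    ENNReal.ofReal (circleAverage (fun z => ‖F z‖) 0 ρ) ≤
      ∫⁻ s, ENNReal.ofReal (circleAverage (fun z => ‖Φ s z‖) 0 ρ) ∂μ := by
  rw [ofReal_circleAverage_norm hρ hF]
  calc _ ≤ ENNReal.ofReal (2 * Real.pi)⁻¹ * ∫⁻ θ in Ioc 0 (2 * Real.pi),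
        ∫⁻ s, ‖Φ s (circleMap 0 ρ θ)‖ₑ ∂μ := by
        gcongr with θ
        rw [hFΦ _ (circleMap_zero_norm hρ θ)]
        exact enorm_integral_le_lintegral_enorm _
    _ = ENNReal.ofReal (2 * Real.pi)⁻¹ * ∫⁻ s, ∫⁻ θ in Ioc 0 (2 * Real.pi),
        ‖Φ s (circleMap 0 ρ θ)‖ₑ ∂volume ∂μ := by
        rw [lintegral_lintegral_swap (f := fun s θ => ‖Φ s (circleMap 0 ρ θ)‖ₑ) hm.enorm]
    _ = ∫⁻ s, ENNReal.ofReal (2 * Real.pi)⁻¹ * ∫⁻ θ in Ioc 0 (2 * Real.pi),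
        ‖Φ s (circleMap 0 ρ θ)‖ₑ ∂volume ∂μ := by
        rw [lintegral_const_mul' _ _ ENNReal.ofReal_ne_top]
    _ = _ := by
        refine lintegral_congr_ae ?_
        filter_upwards [hΦ] with s hs
        rw [ofReal_circleAverage_norm hρ hs]

/-- The integral means of the averaged kernel. -/
lemma exists_circleAverage_avgKernelFun_le {ω : ℝ → ℝ} (hω : IsRadialWeight ω) {C : ℝ} (hC : 1 ≤ C)
    (hd : ∀ r ∈ Ico (0 : ℝ) 1, tail ω r ≤ C * tail ω ((1 + r) / 2)) {A : ℝ}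
    (hA : ∀ a ∈ Ico (0 : ℝ) 1, tailWeight ω a * tail ω a ≤ A * (1 - a)) :
    ∃ D : ℝ≥0, ∀ ρ ∈ Ioo (0 : ℝ) 1, ∀ t ∈ Ico (0 : ℝ) 1,
      ENNReal.ofReal (circleAverage (fun z => ‖avgKernelFun ω (t * z)‖) 0 ρ) ≤
        D * ENNReal.ofReal (tailWeight ω t) := by
  obtain ⟨B, hB, h⟩ := exists_circleAverage_kernelFun_le hω hC hd
  have hA0 : 0 < A := by
    have h1 := hA 0 (by simp)
    have h2 := hω.one_le_tailWeight (a := 0) (by simp)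
    have h3 := hω.tail_pos 0 (by simp)
    have : 0 < tailWeight ω 0 * tail ω 0 := by positivity
    linarith
  have hD0 : 0 ≤ B * A * (2 + 1 / tail ω (1 / 2)) := by
    have := hω.tail_pos (1 / 2) (by constructor <;> norm_num)
    positivity
  refine ⟨(B * A * (2 + 1 / tail ω (1 / 2))).toNNReal, fun ρ hρ t ht => ?_⟩
  have hin : ∀ z : ℂ, ‖z‖ = ρ → z ∈ disc := fun z hz => by simp [disc, hz, hρ.2]
  have htz : ∀ z : ℂ, ‖z‖ = ρ → (t : ℂ) * z ∈ disc := fun z hz =>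
    mul_mem_disc (Ico_subset_Icc_self ht) (hin z hz)
  have hkc := hω.differentiableOn_kernelFun.continuousOn
  -- The averaged kernel is the mean of the dilates `kernelFun ω (s t z)` over `0 < s ≤ 1`.
  have hmink := ofReal_circleAverage_norm_integral_le (μ := volume.restrict (Ioc (0 : ℝ) 1))
    (Φ := fun s z => kernelFun ω (s * (t * z))) (F := fun z => avgKernelFun ω (t * z)) hρ.1.le
    (hω.differentiableOn_avgKernelFun.continuousOn.comp (by fun_prop) fun z hz =>
      htz z (mem_sphere_zero_iff_norm.1 hz))
    ((ae_restrict_iff' measurableSet_Ioc).2 (Eventually.of_forall fun s hs =>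
      hkc.comp (by fun_prop) fun z hz => mul_mem_disc (Ioc_subset_Icc_self hs)
        (htz z (mem_sphere_zero_iff_norm.1 hz))))
    (by
      rw [Measure.prod_restrict]
      refine ContinuousOn.aestronglyMeasurable ?_ (measurableSet_Ioc.prod measurableSet_Ioc)
      refine hkc.comp ?_ fun p hp => mul_mem_disc (Ioc_subset_Icc_self hp.1)
        (htz _ (circleMap_zero_norm hρ.1.le _))
      have := continuous_circleMap 0 ρ
      fun_prop)
    (fun z hz => by
      rw [← hω.integral_kernelFun (htz z hz), intervalIntegral.integral_of_le zero_le_one])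
  refine hmink.trans ?_
  have hpt : ∀ s ∈ Ioc (0 : ℝ) 1,
      ENNReal.ofReal (circleAverage (fun z => ‖kernelFun ω (s * (t * z))‖) 0 ρ) ≤
      ENNReal.ofReal (B * A * (1 / tail ω (t * s))) := by
    intro s hs
    refine ENNReal.ofReal_le_ofReal ?_
    have hst0 : 0 ≤ t * s := mul_nonneg ht.1 hs.1.le
    have hst1 : t * s < 1 := (mul_le_of_le_one_right ht.1 hs.2).trans_lt ht.2
    have hσ : t * s * ρ ∈ Ico (0 : ℝ) 1 :=
      ⟨mul_nonneg hst0 hρ.1.le, (mul_le_of_le_one_right hst0 hρ.2.le).trans_lt hst1⟩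
    have heq : circleAverage (fun z => ‖kernelFun ω (s * (t * z))‖) 0 ρ =
        circleAverage (fun z => ‖kernelFun ω z‖) 0 (t * s * ρ) := by
      simp only [Real.circleAverage_def, circleMap, zero_add]
      congr 3
      ext θ
      congr 2
      push_cast; ring
    rw [heq]
    have htσ := hω.tail_pos _ hσ
    have htst := hω.tail_pos _ ⟨hst0, hst1⟩
    have h1 : 0 < 1 - t * s * ρ := by linarith [hσ.2]
    -- Here `hA` enters, trading `tailWeight / (1 - ·)` for `A / tail`, whose integral in `s` is
    -- controlled by `tailWeight ω t`.
    calc _ ≤ B * tailWeight ω (t * s * ρ) / (1 - t * s * ρ) := h _ hσ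
      _ ≤ B * A * (1 / tail ω (t * s * ρ)) := by
          rw [mul_one_div, div_le_div_iff₀ h1 htσ]
          linarith [mul_le_mul_of_nonneg_left (hA _ hσ) hB.le]
      _ ≤ B * A * (1 / tail ω (t * s)) := by
          gcongr
          exact hω.tail_anti hσ.1 (mul_le_of_le_one_right hst0 hρ.2.le) hst1.le
  refine (setLIntegral_mono' measurableSet_Ioc hpt).trans ?_
  have hint := (hω.intervalIntegrable_inv_tail_mul ht).const_mul (B * A)
  rw [intervalIntegrable_iff_integrableOn_Ioc_of_le zero_le_one] at hint
  rw [← ofReal_integral_eq_lintegral_ofReal hint ((ae_restrict_iff' measurableSet_Ioc).2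
      (Eventually.of_forall fun s hs => by
        have := hω.tail_pos (t * s) ⟨mul_nonneg ht.1 hs.1.le,
          (mul_le_of_le_one_right ht.1 hs.2).trans_lt ht.2⟩
        simp only [Pi.zero_apply]
        positivity)),
    ← intervalIntegral.integral_of_le zero_le_one, intervalIntegral.integral_const_mul]
  change _ ≤ ENNReal.ofReal (B * A * (2 + 1 / tail ω (1 / 2))) * _
  rw [← ENNReal.ofReal_mul hD0, mul_assoc (B * A)]
  exact ENNReal.ofReal_le_ofReal
    (mul_le_mul_of_nonneg_left (hω.integral_inv_tail_mul_le ht) (by positivity))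

/-! ### The Carleson condition -/

/-- The measure `carlesonDensity ω t dt` on `[0,1)`, as a measure on the line. -/
def lineMeasure (ω : ℝ → ℝ) : Measure ℝ :=
  (volume.restrict (Ico (0 : ℝ) 1)).withDensity fun t => ENNReal.ofReal (carlesonDensity ω t)

lemma carlesonDensity_eq (ω : ℝ → ℝ) (t : ℝ) :
    carlesonDensity ω t = ω t * tailWeight ω t := rfl

lemma lineMeasure_Ico (ω : ℝ → ℝ) {a : ℝ} (ha : a ∈ Ico (0 : ℝ) 1) :
    lineMeasure ω (Ico a 1) = ∫⁻ t in Ico a 1, ENNReal.ofReal (carlesonDensity ω t) := by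
  rw [lineMeasure, withDensity_apply _ measurableSet_Ico,
    Measure.restrict_restrict measurableSet_Ico, inter_eq_self_of_subset_left (Ico_subset_Ico_left ha.1)]

lemma lineMeasure_restrict (ω : ℝ → ℝ) :
    (lineMeasure ω).restrict (Ico 0 1) = lineMeasure ω := by
  rw [lineMeasure, restrict_withDensity measurableSet_Ico,
    Measure.restrict_restrict measurableSet_Ico, inter_self]

/-- The tails of the measure `μ_ω` are dominated by `1 - a`. -/
def TailBound (ω : ℝ → ℝ) (A : ℝ≥0) : Prop :=
  ∀ a ∈ Ico (0 : ℝ) 1, lineMeasure ω (Ico a 1) ≤ A * ENNReal.ofReal (1 - a)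

lemma ofReal_div_mul_ofReal_sub {a k : ℝ} (ha : a < 1) :
    ENNReal.ofReal (k / (1 - a)) * ENNReal.ofReal (1 - a) = ENNReal.ofReal k := by
  have : 0 < 1 - a := by linarith
  rw [← ENNReal.ofReal_mul' this.le, div_mul_cancel₀ _ this.ne']

lemma iSup_lt_top_of_tailBound {ω : ℝ → ℝ} {A : ℝ≥0} (h : TailBound ω A) :
    (⨆ a ∈ Ico (0 : ℝ) 1, ENNReal.ofReal (1 / (1 - a)) *
      ∫⁻ t in Ico a 1, ENNReal.ofReal (carlesonDensity ω t)) < ⊤ := by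
  refine lt_of_le_of_lt (iSup₂_le fun a ha => ?_) (ENNReal.coe_lt_top (r := A))
  rw [← lineMeasure_Ico ω ha]
  calc _ ≤ ENNReal.ofReal (1 / (1 - a)) * (A * ENNReal.ofReal (1 - a)) := by
        gcongr; exact h a ha
    _ = A * (ENNReal.ofReal (1 / (1 - a)) * ENNReal.ofReal (1 - a)) := by ring
    _ = A := by rw [ofReal_div_mul_ofReal_sub ha.2]; simp

lemma exists_tailBound_of_mul_le {ω : ℝ → ℝ} {k : ℝ} (hk : 0 < k) {B : ℝ≥0∞} (hB : B ≠ ⊤)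
    (h : ∀ a ∈ Ico (0 : ℝ) 1, ENNReal.ofReal (k / (1 - a)) * lineMeasure ω (Ico a 1) ≤ B) :
    ∃ A, TailBound ω A := by
  have hk0 : ENNReal.ofReal k ≠ 0 := by simpa using hk
  refine ⟨(B / ENNReal.ofReal k).toNNReal, fun a ha => ?_⟩
  rw [ENNReal.coe_toNNReal (ENNReal.div_lt_top hB hk0).ne, ENNReal.mul_comm_div,
    mul_comm, ← ENNReal.mul_div_right_comm]
  rw [ENNReal.le_div_iff_mul_le (Or.inl hk0) (Or.inl ENNReal.ofReal_ne_top),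
    ← ofReal_div_mul_ofReal_sub ha.2]
  calc _ = (ENNReal.ofReal (k / (1 - a)) * lineMeasure ω (Ico a 1)) * ENNReal.ofReal (1 - a) := by
        ring
    _ ≤ B * ENNReal.ofReal (1 - a) := by gcongr; exact h a ha
    _ = _ := by ring

lemma exists_tailBound_of_iSup_lt_top {ω : ℝ → ℝ}
    (h : (⨆ a ∈ Ico (0 : ℝ) 1, ENNReal.ofReal (1 / (1 - a)) *
      ∫⁻ t in Ico a 1, ENNReal.ofReal (carlesonDensity ω t)) < ⊤) : ∃ A, TailBound ω A := by
  refine exists_tailBound_of_mul_le one_pos h.ne fun a ha => ?_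
  rw [lineMeasure_Ico ω ha]
  exact le_iSup₂ (f := fun a (_ : a ∈ Ico (0 : ℝ) 1) => ENNReal.ofReal (1 / (1 - a)) *
      ∫⁻ t in Ico a 1, ENNReal.ofReal (carlesonDensity ω t)) a ha

lemma real_mem_disc {t : ℝ} (ht : t ∈ Ico (0 : ℝ) 1) : (t : ℂ) ∈ disc := by
  simp [disc, abs_of_nonneg ht.1, ht.2]

lemma measurableEmbedding_ofReal : MeasurableEmbedding (fun t : ℝ => (t : ℂ)) :=
  Complex.isometry_ofReal.isClosedEmbedding.measurableEmbedding

lemma lintegral_radialMeasure (ω : ℝ → ℝ) (f : ℂ → ℝ≥0∞) :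
    ∫⁻ z, f z ∂radialMeasure ω = ∫⁻ t in Ico (0 : ℝ) 1, f t ∂lineMeasure ω := by
  rw [lineMeasure_restrict]
  exact measurableEmbedding_ofReal.lintegral_map f

lemma continuousOn_comp_ofReal {f : ℂ → ℂ} (hf : DifferentiableOn ℂ f disc) :
    ContinuousOn (fun t : ℝ => f t) (Ico 0 1) :=
  hf.continuousOn.comp (by fun_prop) fun _ ht => real_mem_disc ht

lemma isCarlesonForHardy_of_tailBound {ω : ℝ → ℝ} {A : ℝ≥0} (h : TailBound ω A) :
    IsCarlesonForHardy 1 (radialMeasure ω) := by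
  refine ⟨8 * A, fun f hf => ?_⟩
  have hle : eLpNorm f 1 (radialMeasure ω) ≤ (8 * A : ℝ≥0) * hardyNorm f := by
    rw [eLpNorm_one_eq_lintegral_enorm, lintegral_radialMeasure]
    simpa using setLIntegral_enorm_le_hardyNorm h hf.analytic
  refine ⟨⟨?_, hle.trans_lt (ENNReal.mul_lt_top ENNReal.coe_lt_top hf.norm_lt_top)⟩, hle⟩
  refine measurableEmbedding_ofReal.aestronglyMeasurable_map_iff.2 ?_
  exact ((continuousOn_comp_ofReal hf.analytic).aestronglyMeasurable measurableSet_Ico).mono_ac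
    (withDensity_absolutelyContinuous _ _)

/-! ### Test functions -/

/-- The test functions `(1 - a) / (1 - a z)²`. -/
def testFun (a : ℝ) (z : ℂ) : ℂ := (1 - a) / (1 - a * z) ^ 2

/-- The values of the test functions on the radius. -/
lemma testFun_ofReal (a t : ℝ) : testFun a t = (((1 - a) / (1 - a * t) ^ 2 : ℝ) : ℂ) := by
  simp [testFun]

lemma one_sub_mul_ne_zero {a : ℝ} (ha : a ∈ Ico (0 : ℝ) 1) {z : ℂ} (hz : z ∈ disc) :
    1 - a * z ≠ 0 := by
  intro h
  have h1 := mul_mem_disc (Ico_subset_Icc_self ha) hz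
  rw [← sub_eq_zero.1 h] at h1
  simp [disc] at h1

lemma differentiableOn_testFun {a : ℝ} (ha : a ∈ Ico (0 : ℝ) 1) :
    DifferentiableOn ℂ (testFun a) disc :=
  DifferentiableOn.div (by fun_prop) (by fun_prop) fun _ hz =>
    pow_ne_zero 2 (one_sub_mul_ne_zero ha hz)

/-- The modulus is `(1-a)` times the square of that of a geometric series, so Parseval bounds the
mean by `(1-a) ∑ a^n = 1`. -/
lemma hardyNorm_testFun_le {a : ℝ} (ha : a ∈ Ico (0 : ℝ) 1) : hardyNorm (testFun a) ≤ 1 := by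
  refine iSup₂_le fun ρ hρ => ?_
  rw [ENNReal.ofReal_le_one]
  have h0 := ha.1
  have hρ0 := hρ.1.le
  have h1 : 0 < 1 - a := by linarith [ha.2]
  have haρ : a * ρ ≤ a := mul_le_of_le_one_right h0 hρ.2.le
  have hs : Summable fun n => ‖(a : ℂ) ^ n‖ * ρ ^ n := by
    have := summable_geometric_of_lt_one (mul_nonneg h0 hρ0) (haρ.trans_lt ha.2)
    simpa [abs_of_nonneg h0, mul_pow] using this
  have hP := hasSum_circleAverage_norm_sq (a := fun n => (a : ℂ) ^ n)
    (F := fun z => (1 - a * z)⁻¹) hρ0 hs (fun z hz => by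
      simp_rw [← mul_pow]
      refine hasSum_geometric_of_norm_lt_one ?_
      rw [norm_mul, hz, Complex.norm_real, Real.norm_of_nonneg h0]
      exact haρ.trans_lt ha.2)
  have hle : circleAverage (fun z : ℂ => ‖(1 - a * z)⁻¹‖ ^ 2) 0 ρ ≤ (1 - a)⁻¹ := by
    refine hasSum_le (fun n => ?_) hP (hasSum_geometric_of_lt_one h0 ha.2)
    rw [norm_pow, Complex.norm_real, Real.norm_of_nonneg h0]
    have h2 : ρ ^ (2 * n) ≤ 1 := pow_le_one₀ hρ0 hρ.2.le
    have h3 : a ^ n ≤ 1 := pow_le_one₀ h0 ha.2.le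
    have h4 : 0 ≤ a ^ n := by positivity
    calc (a ^ n) ^ 2 * ρ ^ (2 * n) ≤ (a ^ n) ^ 2 * 1 := by gcongr
      _ ≤ a ^ n := by nlinarith
  have heq : circleAverage (fun z => ‖testFun a z‖) 0 ρ =
      circleAverage (fun z : ℂ => (1 - a) • ‖(1 - a * z)⁻¹‖ ^ 2) 0 ρ := by
    congr 1
    ext z
    have : ‖(1 : ℂ) - a‖ = 1 - a := by
      rw [← Complex.ofReal_one, ← Complex.ofReal_sub, Complex.norm_real, Real.norm_of_nonneg h1.le]
    simp [testFun, this, div_eq_mul_inv]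
  rw [heq, Real.circleAverage_fun_smul, smul_eq_mul]
  calc _ ≤ (1 - a) * (1 - a)⁻¹ := by gcongr
    _ = 1 := mul_inv_cancel₀ h1.ne'

lemma memHardy_testFun {a : ℝ} (ha : a ∈ Ico (0 : ℝ) 1) : MemHardy (testFun a) :=
  ⟨differentiableOn_testFun ha, (hardyNorm_testFun_le ha).trans_lt ENNReal.one_lt_top⟩

lemma le_testFun_ofReal {a t : ℝ} (ha : a ∈ Ico (0 : ℝ) 1) (ht : t ∈ Ico a 1) :
    1 / 4 / (1 - a) ≤ (1 - a) / (1 - a * t) ^ 2 := by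
  have h1 : 0 < 1 - a := by linarith [ha.2]
  have h2 : 0 < 1 - a * t := by nlinarith [ha.1, ha.2, ht.1, ht.2]
  have h3 : 1 - a * t ≤ 2 * (1 - a) := by nlinarith [ha.1, ha.2, ht.1, ht.2]
  rw [div_le_div_iff₀ h1 (by positivity)]
  have : (1 - a * t) ^ 2 ≤ (2 * (1 - a)) ^ 2 := by gcongr
  nlinarith

lemma exists_tailBound_of_isCarlesonForHardy {ω : ℝ → ℝ}
    (h : IsCarlesonForHardy 1 (radialMeasure ω)) : ∃ A, TailBound ω A := by
  obtain ⟨C, hC⟩ := h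
  refine exists_tailBound_of_mul_le (k := 1 / 4) (by norm_num) (B := C) ENNReal.coe_ne_top
    fun a ha => ?_
  have h1 := (hC _ (memHardy_testFun ha)).2
  rw [eLpNorm_one_eq_lintegral_enorm, lintegral_radialMeasure] at h1
  calc ENNReal.ofReal (1 / 4 / (1 - a)) * lineMeasure ω (Ico a 1)
      = ∫⁻ t in Ico a 1, ENNReal.ofReal (1 / 4 / (1 - a)) ∂lineMeasure ω := by
        rw [setLIntegral_const]
    _ ≤ ∫⁻ t in Ico a 1, ‖testFun a t‖ₑ ∂lineMeasure ω := by
        refine setLIntegral_mono' measurableSet_Ico fun t ht => ?_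
        rw [← ofReal_norm, testFun_ofReal, Complex.norm_real]
        exact ENNReal.ofReal_le_ofReal ((le_testFun_ofReal ha ht).trans (le_abs_self _))
    _ ≤ ∫⁻ t in Ico 0 1, ‖testFun a t‖ₑ ∂lineMeasure ω :=
        lintegral_mono_set (Ico_subset_Ico_left ha.1)
    _ ≤ C * hardyNorm (testFun a) := h1
    _ ≤ C * 1 := by gcongr; exact hardyNorm_testFun_le ha
    _ = C := mul_one _

/-! ### The Hilbert-type operator -/

lemma avgKernelFun_ofReal (ω : ℝ → ℝ) (y : ℝ) :
    avgKernelFun ω (y : ℂ) = ((∑' n, avgCoeff ω n * y ^ n : ℝ) : ℂ) := by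
  simp [avgKernelFun, Complex.ofReal_tsum]

/-- Since `tailWeight` increases, its value at `a` can be taken out of the integral over `[a,1)`.
This pointwise form of (iii) is what the kernel estimate uses. -/
lemma IsRadialWeight.tailWeight_mul_tail_le {ω : ℝ → ℝ} (hω : IsRadialWeight ω)
    {A : ℝ≥0} (h : TailBound ω A) {a : ℝ}
    (ha : a ∈ Ico (0 : ℝ) 1) : tailWeight ω a * tail ω a ≤ A * (1 - a) := by
  have h1 := h a ha
  have hsub : Ico a 1 ⊆ Ico (0 : ℝ) 1 := Ico_subset_Ico_left ha.1
  have hW := hω.one_le_tailWeight ha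
  rw [lineMeasure_Ico ω ha] at h1
  have h2 : ENNReal.ofReal (tailWeight ω a * tail ω a) ≤
      ∫⁻ t in Ico a 1, ENNReal.ofReal (carlesonDensity ω t) := by
    rw [tail_eq_setIntegral ω ha.2.le, ← integral_const_mul, ofReal_integral_eq_lintegral_ofReal
      ((hω.integrable.mono_set hsub).const_mul _) ((ae_restrict_iff' measurableSet_Ico).2
        (Eventually.of_forall fun t ht => mul_nonneg (by linarith) (hω.nonneg t (hsub ht))))]
    refine setLIntegral_mono' measurableSet_Ico fun t ht => ENNReal.ofReal_le_ofReal ?_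
    rw [carlesonDensity_eq, mul_comm]
    exact mul_le_mul_of_nonneg_left (hω.tailWeight_mono ha.1 ht.1 ht.2) (hω.nonneg t (hsub ht))
  have h3 := h2.trans h1
  have h4 : (0 : ℝ) ≤ 1 - a := by linarith [ha.2]
  rwa [← ENNReal.ofReal_coe_nnreal, ← ENNReal.ofReal_mul A.coe_nonneg,
    ENNReal.ofReal_le_ofReal_iff (by positivity)] at h3

lemma IsRadialWeight.aemeasurable_carlesonDensity {ω : ℝ → ℝ} (hω : IsRadialWeight ω) :
    AEMeasurable (fun t => ENNReal.ofReal (carlesonDensity ω t)) (volume.restrict (Ico 0 1)) :=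
  (hω.integrable.1.aemeasurable.mul
    (hω.continuousOn_tailWeight.aemeasurable measurableSet_Ico)).ennreal_ofReal

lemma IsRadialWeight.lintegral_lineMeasure {ω : ℝ → ℝ} (hω : IsRadialWeight ω) (g : ℝ → ℝ≥0∞) :
    ∫⁻ t in Ico (0 : ℝ) 1, g t ∂lineMeasure ω =
      ∫⁻ t in Ico (0 : ℝ) 1, ENNReal.ofReal (ω t * tailWeight ω t) * g t := by
  rw [lineMeasure_restrict]
  exact lintegral_withDensity_eq_lintegral_mul_non_measurable₀ _ hω.aemeasurable_carlesonDensity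
    (Eventually.of_forall fun _ => ENNReal.ofReal_lt_top) g

lemma IsRadialWeight.hilbertIntegrand_eq {ω : ℝ → ℝ} (hω : IsRadialWeight ω)
    (f : ℂ → ℂ) {z : ℂ} (hz : z ∈ disc) {t : ℝ}
    (ht : t ∈ Ico (0 : ℝ) 1) :
    hilbertIntegrand ω f z t = avgKernelFun ω (t * z) * (f t * (ω t : ℂ)) := by
  rw [hilbertIntegrand, hω.averagedKernel_eq ht hz]; ring

lemma IsRadialWeight.hilbertOp_eq {ω : ℝ → ℝ} (hω : IsRadialWeight ω)
    (f : ℂ → ℂ) {z : ℂ} (hz : z ∈ disc) :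
    hilbertOp ω f z = ∫ t in Ico (0 : ℝ) 1, avgKernelFun ω (t * z) * (f t * (ω t : ℂ)) :=
  setIntegral_congr_fun measurableSet_Ico fun _ ht => hω.hilbertIntegrand_eq f hz ht

lemma IsRadialWeight.norm_avgKernelFun_le {ω : ℝ → ℝ} (hω : IsRadialWeight ω)
    {t : ℝ} (ht : t ∈ Icc (0 : ℝ) 1) {z : ℂ}
    (hz : z ∈ disc) : ‖avgKernelFun ω (t * z)‖ ≤ ∑' n, avgCoeff ω n * ‖z‖ ^ n := by
  have hz1 : ‖z‖ < 1 := by simpa [disc] using hz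
  refine tsum_of_norm_bounded (hω.summable_avgCoeff (norm_nonneg z) hz1).hasSum fun n => ?_
  have := hω.avgCoeff_nonneg n
  have h0 := ht.1
  simp only [norm_mul, norm_pow, Complex.norm_real, Real.norm_of_nonneg h0,
    Real.norm_of_nonneg this]
  gcongr
  exact mul_le_of_le_one_left (norm_nonneg z) ht.2

lemma IsRadialWeight.integrableOn_hilbertIntegrand {ω : ℝ → ℝ} (hω : IsRadialWeight ω) {f : ℂ → ℂ}
    (hf : IntegrableOn (fun t : ℝ => f t * (ω t : ℂ)) (Ico 0 1)) {z : ℂ} (hz : z ∈ disc) :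
    IntegrableOn (hilbertIntegrand ω f z) (Ico 0 1) := by
  have hc : ContinuousOn (fun t : ℝ => avgKernelFun ω (t * z)) (Ico 0 1) :=
    hω.differentiableOn_avgKernelFun.continuousOn.comp (by fun_prop) fun t ht =>
      mul_mem_disc (Ico_subset_Icc_self ht) hz
  have : IntegrableOn (fun t : ℝ => avgKernelFun ω (t * z) * (f t * (ω t : ℂ))) (Ico 0 1) :=
    hf.bdd_mul (hc.aestronglyMeasurable measurableSet_Ico)
      ((ae_restrict_iff' measurableSet_Ico).2 (Eventually.of_forall fun t ht =>
        hω.norm_avgKernelFun_le (Ico_subset_Icc_self ht) hz))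
  exact this.congr_fun (fun t ht => (hω.hilbertIntegrand_eq f hz ht).symm) measurableSet_Ico

/-- Integrating the kernel series termwise gives a power series with coefficients `avgCoeff ω n`
times the moments of `f ω`, which are bounded. -/
lemma IsRadialWeight.differentiableOn_hilbertOp {ω : ℝ → ℝ} (hω : IsRadialWeight ω) {f : ℂ → ℂ}
    (hf : IntegrableOn (fun t : ℝ => f t * (ω t : ℂ)) (Ico 0 1)) :
    DifferentiableOn ℂ (hilbertOp ω f) disc := by
  set M := ∫ t in Ico (0 : ℝ) 1, ‖f t * (ω t : ℂ)‖ with hM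
  set m : ℕ → ℂ := fun n => ∫ t in Ico (0 : ℝ) 1, (t : ℂ) ^ n * (f t * (ω t : ℂ)) with hm
  have hpow (n : ℕ) : ∀ t ∈ Ico (0 : ℝ) 1, ‖(t : ℂ) ^ n‖ ≤ 1 := fun t ht => by
    rw [norm_pow, Complex.norm_real, Real.norm_of_nonneg ht.1]
    exact pow_le_one₀ ht.1 ht.2.le
  have hint (n : ℕ) : IntegrableOn (fun t : ℝ => (t : ℂ) ^ n * (f t * (ω t : ℂ))) (Ico 0 1) :=
    hf.bdd_mul (by fun_prop : Continuous fun t : ℝ => (t : ℂ) ^ n).aestronglyMeasurable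
      ((ae_restrict_iff' measurableSet_Ico).2 (Eventually.of_forall (hpow n)))
  have hnorm (n : ℕ) : ∫ t in Ico (0 : ℝ) 1, ‖(t : ℂ) ^ n * (f t * (ω t : ℂ))‖ ≤ M := by
    refine setIntegral_mono_on (hint n).norm hf.norm measurableSet_Ico fun t ht => ?_
    rw [norm_mul]
    exact mul_le_of_le_one_left (norm_nonneg _) (hpow n t ht)
  have hd := differentiableOn_disc_tsum (a := fun n => (avgCoeff ω n : ℂ) * m n) fun ρ hρ => by
    refine Summable.of_nonneg_of_le
      (fun n => mul_nonneg (norm_nonneg _) (pow_nonneg hρ.1 n)) (fun n => ?_)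
      ((hω.summable_norm_avgCoeff hρ).mul_right M)
    rw [norm_mul, mul_right_comm]
    have h1 : ‖m n‖ ≤ M := (norm_integral_le_integral_norm _).trans (hnorm n)
    have := hρ.1
    gcongr
  refine hd.congr fun z hz => ?_
  have hz1 : ‖z‖ < 1 := by simpa [disc] using hz
  have h := hasSum_integral_of_summable_integral_norm
    (F := fun n (t : ℝ) => ((avgCoeff ω n : ℂ) * z ^ n) * ((t : ℂ) ^ n * (f t * (ω t : ℂ))))
    (μ := volume.restrict (Ico (0 : ℝ) 1)) (fun n => (hint n).const_mul _) (by
      simp_rw [norm_mul ((avgCoeff ω _ : ℂ) * z ^ _), integral_const_mul]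
      refine Summable.of_nonneg_of_le (fun n => by positivity) (fun n => ?_)
        ((hω.summable_norm_avgCoeff ⟨norm_nonneg z, hz1⟩).mul_right M)
      rw [norm_mul, norm_pow]
      gcongr
      exact hnorm n)
  simp_rw [integral_const_mul] at h
  rw [hω.hilbertOp_eq f hz]
  have h2 : ∫ t in Ico (0 : ℝ) 1, avgKernelFun ω (t * z) * (f t * (ω t : ℂ)) =
      ∫ t in Ico (0 : ℝ) 1, ∑' n, ((avgCoeff ω n : ℂ) * z ^ n) *
        ((t : ℂ) ^ n * (f t * (ω t : ℂ))) := by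
    refine setIntegral_congr_fun measurableSet_Ico fun t _ => ?_
    simp only [avgKernelFun]
    rw [← tsum_mul_right]
    exact tsum_congr fun n => by ring
  rw [h2, ← h.tsum_eq]
  exact tsum_congr fun n => by simp only [hm]; ring

lemma hilbertBoundedOnHardy_of_tailBound {ω : ℝ → ℝ} (hω : IsRadialWeight ω) {C : ℝ} (hC : 1 ≤ C)
    (hd : ∀ r ∈ Ico (0 : ℝ) 1, tail ω r ≤ C * tail ω ((1 + r) / 2)) {A : ℝ≥0}
    (h : TailBound ω A) : HilbertBoundedOnHardy ω := by
  obtain ⟨D, hD⟩ := exists_circleAverage_avgKernelFun_le hω hC hd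
    (fun a ha => hω.tailWeight_mul_tail_le h ha)
  refine ⟨D * (8 * A), fun f hf => ?_⟩
  have hcarl := setLIntegral_enorm_le_hardyNorm h hf.analytic
  rw [hω.lintegral_lineMeasure] at hcarl
  have hmeas : AEStronglyMeasurable (fun t : ℝ => f t * (ω t : ℂ)) (volume.restrict (Ico 0 1)) :=
    ((continuousOn_comp_ofReal hf.analytic).aestronglyMeasurable measurableSet_Ico).mul
      (Complex.continuous_ofReal.comp_aestronglyMeasurable hω.integrable.1)
  have hpt : ∀ t ∈ Ico (0 : ℝ) 1, ‖f t * (ω t : ℂ)‖ₑ * ENNReal.ofReal (tailWeight ω t) =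
      ENNReal.ofReal (ω t * tailWeight ω t) * ‖f t‖ₑ := by
    intro t ht
    have h1 := hω.nonneg t ht
    have h2 : ‖(ω t : ℂ)‖ₑ = ENNReal.ofReal (ω t) := by
      rw [← ofReal_norm, Complex.norm_real, Real.norm_of_nonneg h1]
    rw [enorm_mul, h2, ENNReal.ofReal_mul h1]; ring
  -- As `tailWeight ≥ 1`, integrability against `ω` follows from the Carleson bound against `ω *
  -- tailWeight`.
  have hint : IntegrableOn (fun t : ℝ => f t * (ω t : ℂ)) (Ico 0 1) := by
    refine ⟨hmeas, hasFiniteIntegral_iff_enorm.2 (lt_of_le_of_lt ?_ (hcarl.trans_lt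
      (ENNReal.mul_lt_top (by finiteness) hf.norm_lt_top)))⟩
    refine setLIntegral_mono' measurableSet_Ico fun t ht => ?_
    rw [← hpt t ht]
    refine le_mul_of_one_le_right' ?_
    rw [ENNReal.one_le_ofReal]
    exact hω.one_le_tailWeight ht
  have hdiff := hω.differentiableOn_hilbertOp hint
  have hnorm : hardyNorm (hilbertOp ω f) ≤ (D * (8 * A) : ℝ≥0) * hardyNorm f := by
    refine iSup₂_le fun ρ hρ => ?_
    have hin : ∀ z : ℂ, ‖z‖ = ρ → z ∈ disc := fun z hz => by simp [disc, hz, hρ.2]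
    have hkc := hω.differentiableOn_avgKernelFun.continuousOn
    have hkt : ∀ t ∈ Ico (0 : ℝ) 1,
        ContinuousOn (fun z : ℂ => avgKernelFun ω (t * z)) (Metric.sphere 0 ρ) := fun t ht =>
      hkc.comp (by fun_prop) fun z hz => mul_mem_disc (Ico_subset_Icc_self ht)
        (hin z (mem_sphere_zero_iff_norm.1 hz))
    have hmink := ofReal_circleAverage_norm_integral_le (μ := volume.restrict (Ico (0 : ℝ) 1))
      (Φ := fun t z => avgKernelFun ω (t * z) * (f t * (ω t : ℂ))) (F := hilbertOp ω f) hρ.1.le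
      (hdiff.continuousOn.mono fun z hz => hin z (mem_sphere_zero_iff_norm.1 hz))
      ((ae_restrict_iff' measurableSet_Ico).2 (Eventually.of_forall fun t ht =>
        (hkt t ht).mul continuousOn_const))
      (by
        refine AEStronglyMeasurable.mul ?_ hmeas.comp_fst
        rw [Measure.prod_restrict]
        refine ContinuousOn.aestronglyMeasurable ?_ (measurableSet_Ico.prod measurableSet_Ioc)
        refine hkc.comp ?_ fun p hp => mul_mem_disc (Ico_subset_Icc_self hp.1)
          (hin _ (circleMap_zero_norm hρ.1.le _))
        have := continuous_circleMap 0 ρ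
        fun_prop)
      (fun z hz => hω.hilbertOp_eq f (hin z hz))
    refine hmink.trans ?_
    calc _ ≤ ∫⁻ t in Ico (0 : ℝ) 1, D * (ENNReal.ofReal (ω t * tailWeight ω t) * ‖f t‖ₑ) := by
          refine setLIntegral_mono' measurableSet_Ico fun t ht => ?_
          rw [← hpt t ht]
          have heq : circleAverage (fun z : ℂ => ‖avgKernelFun ω (t * z) * (f t * (ω t : ℂ))‖) 0 ρ =
              ‖f t * (ω t : ℂ)‖ * circleAverage (fun z : ℂ => ‖avgKernelFun ω (t * z)‖) 0 ρ := by
            rw [← smul_eq_mul (α := ℝ), ← Real.circleAverage_fun_smul]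
            congr 1
            ext z
            rw [norm_mul, smul_eq_mul, mul_comm]
          rw [heq, ENNReal.ofReal_mul (norm_nonneg _), ofReal_norm]
          calc _ ≤ ‖f t * (ω t : ℂ)‖ₑ * (D * ENNReal.ofReal (tailWeight ω t)) := by
                gcongr; exact hD ρ hρ t ht
            _ = _ := by ring
      _ = D * ∫⁻ t in Ico (0 : ℝ) 1, ENNReal.ofReal (ω t * tailWeight ω t) * ‖f t‖ₑ :=
          lintegral_const_mul' _ _ ENNReal.coe_ne_top
      _ ≤ D * (8 * A * hardyNorm f) := by gcongr
      _ = _ := by push_cast; ring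
  exact ⟨fun z hz => hω.integrableOn_hilbertIntegrand hint hz,
    ⟨hdiff, hnorm.trans_lt (ENNReal.mul_lt_top ENNReal.coe_lt_top hf.norm_lt_top)⟩, hnorm⟩

lemma exists_tailBound_of_hilbertBoundedOnHardy {ω : ℝ → ℝ} (hω : IsRadialWeight ω)
    {C : ℝ} (hC : 1 ≤ C)
    (hd : ∀ r ∈ Ico (0 : ℝ) 1, tail ω r ≤ C * tail ω ((1 + r) / 2))
    (h : HilbertBoundedOnHardy ω) : ∃ A, TailBound ω A := by
  obtain ⟨B, hB⟩ := h
  obtain ⟨c, hc, hlow⟩ := exists_div_tail_le_tsum hω hC hd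
  have ht0 := hω.tail_pos 0 (by simp)
  set c' := c / (tail ω 0 + 1) with hc'
  have hc'0 : 0 < c' := by positivity
  -- The factor `c'` is the lower bound for the mean of the kernel over the radius relative to
  -- `tailWeight`, `1/4` comes from the size of the test function on `[a,1)`, and `8` from the
  -- Fejér–Riesz inequality.
  refine exists_tailBound_of_mul_le (k := c' * (1 / 4)) (by positivity) (B := 8 * B)
    (by finiteness) fun a ha => ?_
  obtain ⟨hint, hmem, hle⟩ := hB _ (memHardy_testFun ha)
  set φ : ℝ → ℝ := fun t => (1 - a) / (1 - a * t) ^ 2 with hφ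
  have h1a : 0 < 1 - a := by linarith [ha.2]
  have hφ0 : ∀ t, 0 ≤ φ t := fun t => by simp only [hφ]; positivity
  -- Fejér–Riesz: Lebesgue measure satisfies the tail hypothesis with constant `1`.
  have hFR : ∫⁻ x in Ico (0 : ℝ) 1, ‖hilbertOp ω (testFun a) x‖ₑ ≤ 8 * B := by
    have h1 := setLIntegral_enorm_le_hardyNorm (ν := volume) (A := 1)
      (fun a _ => by simp) hmem.analytic
    calc _ ≤ _ := h1
      _ ≤ 8 * ((1 : ℝ≥0) : ℝ≥0∞) * (B * 1) := by
          gcongr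
          exact hle.trans (by gcongr; exact hardyNorm_testFun_le ha)
      _ = _ := by simp
  have hpoint : ∀ x ∈ Ico (0 : ℝ) 1, ∫⁻ t in Ico (0 : ℝ) 1,
      ENNReal.ofReal (φ t * ω t) * ENNReal.ofReal (c * (1 / tail ω (t * x))) ≤
      ‖hilbertOp ω (testFun a) x‖ₑ := by
    intro x hx
    -- On the radius the kernel and the test function are real and nonnegative, so the modulus of
    -- `H_ω f` is the integral itself and a pointwise lower bound for the kernel may be inserted.
    set ψ : ℝ → ℝ := fun t => (∑' n, avgCoeff ω n * (t * x) ^ n) * (φ t * ω t) with hψ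
    have hev : ∀ t ∈ Ico (0 : ℝ) 1, hilbertIntegrand ω (testFun a) x t = (ψ t : ℂ) := by
      intro t ht
      rw [hω.hilbertIntegrand_eq _ (real_mem_disc hx) ht, ← Complex.ofReal_mul,
        avgKernelFun_ofReal, testFun_ofReal]
      simp only [hψ, hφ]
      push_cast
      rfl
    have htx : ∀ t ∈ Ico (0 : ℝ) 1, t * x ∈ Ico (0 : ℝ) 1 := fun t ht =>
      ⟨mul_nonneg ht.1 hx.1, (mul_le_of_le_one_right ht.1 hx.2.le).trans_lt ht.2⟩
    have hψle : ∀ t ∈ Ico (0 : ℝ) 1, φ t * ω t * (c * (1 / tail ω (t * x))) ≤ ψ t := by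
      intro t ht
      have := hlow _ (htx t ht)
      rw [mul_comm, mul_one_div]
      exact mul_le_mul_of_nonneg_right this (mul_nonneg (hφ0 t) (hω.nonneg t ht))
    have hψ0 : ∀ t ∈ Ico (0 : ℝ) 1, 0 ≤ ψ t := fun t ht => by
      refine le_trans ?_ (hψle t ht)
      have := hω.tail_pos _ (htx t ht)
      have := hω.nonneg t ht
      have := hφ0 t
      positivity
    have hψi : IntegrableOn ψ (Ico 0 1) := by
      have := ((hint x (real_mem_disc hx)).congr_fun hev measurableSet_Ico).re
      simp only [RCLike.re_to_complex, Complex.ofReal_re] at this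
      exact this
    have hop : hilbertOp ω (testFun a) x = ((∫ t in Ico (0 : ℝ) 1, ψ t : ℝ) : ℂ) := by
      rw [hilbertOp, setIntegral_congr_fun measurableSet_Ico hev, integral_complex_ofReal]
    rw [hop, ← ofReal_norm, Complex.norm_real,
      Real.norm_of_nonneg (setIntegral_nonneg measurableSet_Ico hψ0),
      ofReal_integral_eq_lintegral_ofReal hψi
        ((ae_restrict_iff' measurableSet_Ico).2 (Eventually.of_forall hψ0))]
    refine setLIntegral_mono' measurableSet_Ico fun t ht => ?_
    rw [← ENNReal.ofReal_mul (mul_nonneg (hφ0 t) (hω.nonneg t ht))]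
    exact ENNReal.ofReal_le_ofReal (hψle t ht)
  have hinner : ∀ t ∈ Ico (0 : ℝ) 1, ENNReal.ofReal (c' * tailWeight ω t) ≤
      ∫⁻ x in Ico (0 : ℝ) 1, ENNReal.ofReal (c * (1 / tail ω (t * x))) := by
    intro t ht
    have hi := (hω.intervalIntegrable_inv_tail_mul ht).const_mul c
    rw [intervalIntegrable_iff_integrableOn_Ico_of_le zero_le_one] at hi
    rw [← ofReal_integral_eq_lintegral_ofReal hi ((ae_restrict_iff' measurableSet_Ico).2
        (Eventually.of_forall fun x hx => by
          have := hω.tail_pos (t * x) ⟨mul_nonneg ht.1 hx.1,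
            (mul_le_of_le_one_right ht.1 hx.2.le).trans_lt ht.2⟩
          simp only [Pi.zero_apply]
          positivity)), integral_Ico_eq_integral_Ioc,
      ← intervalIntegral.integral_of_le zero_le_one, intervalIntegral.integral_const_mul]
    refine ENNReal.ofReal_le_ofReal ?_
    have := hω.tailWeight_le_integral_inv_tail_mul ht
    rw [hc', div_mul_eq_mul_div, div_le_iff₀ (by positivity), mul_assoc]
    gcongr
    linarith
  -- Joint measurability for Tonelli: the `x`-integral has to be done first, since it is what
  -- produces `tailWeight ω t`.
  have hmeas : AEMeasurable (Function.uncurry fun x t : ℝ =>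
      ENNReal.ofReal (φ t * ω t) * ENNReal.ofReal (c * (1 / tail ω (t * x))))
      ((volume.restrict (Ico (0 : ℝ) 1)).prod (volume.restrict (Ico (0 : ℝ) 1))) := by
    refine AEMeasurable.mul (f := fun p : ℝ × ℝ => ENNReal.ofReal (φ p.2 * ω p.2))
      (g := fun p : ℝ × ℝ => ENNReal.ofReal (c * (1 / tail ω (p.2 * p.1)))) ?_ ?_
    · have h1 : AEMeasurable (fun t => ENNReal.ofReal (φ t * ω t))
          (volume.restrict (Ico (0 : ℝ) 1)) := by
        refine (AEMeasurable.mul ?_ hω.integrable.1.aemeasurable).ennreal_ofReal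
        exact Measurable.aemeasurable (by simp only [hφ]; fun_prop)
      exact h1.comp_snd
    · refine AEMeasurable.ennreal_ofReal (AEMeasurable.const_mul ?_ c)
      rw [Measure.prod_restrict]
      refine ContinuousOn.aemeasurable ?_ (measurableSet_Ico.prod measurableSet_Ico)
      refine hω.continuousOn_inv_tail.comp (f := fun p : ℝ × ℝ => p.2 * p.1) (by fun_prop)
        fun p hp => ?_
      exact ⟨mul_nonneg hp.2.1 hp.1.1, (mul_le_of_le_one_right hp.2.1 hp.1.2.le).trans_lt hp.2.2⟩
  rw [lineMeasure_Ico ω ha, ← lintegral_const_mul' _ _ ENNReal.ofReal_ne_top]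
  calc ∫⁻ t in Ico a 1, ENNReal.ofReal (c' * (1 / 4) / (1 - a)) *
        ENNReal.ofReal (carlesonDensity ω t)
      ≤ ∫⁻ t in Ico a 1, ENNReal.ofReal (φ t * ω t) * ENNReal.ofReal (c' * tailWeight ω t) := by
        refine setLIntegral_mono' measurableSet_Ico fun t ht => ?_
        have ht' : t ∈ Ico (0 : ℝ) 1 := ⟨ha.1.trans ht.1, ht.2⟩
        have hw := hω.nonneg t ht'
        have hW := hω.one_le_tailWeight ht'
        rw [← ENNReal.ofReal_mul (by positivity), ← ENNReal.ofReal_mul (mul_nonneg (hφ0 t) hw),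
          carlesonDensity_eq]
        refine ENNReal.ofReal_le_ofReal ?_
        have h1 := le_testFun_ofReal ha ht
        calc c' * (1 / 4) / (1 - a) * (ω t * tailWeight ω t)
            = (1 / 4 / (1 - a)) * (ω t * (c' * tailWeight ω t)) := by ring
          _ ≤ φ t * (ω t * (c' * tailWeight ω t)) :=
              mul_le_mul_of_nonneg_right h1 (by positivity)
          _ = _ := by ring
    _ ≤ ∫⁻ t in Ico (0 : ℝ) 1, ENNReal.ofReal (φ t * ω t) *
        ENNReal.ofReal (c' * tailWeight ω t) := lintegral_mono_set (Ico_subset_Ico_left ha.1)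
    _ ≤ ∫⁻ t in Ico (0 : ℝ) 1, ∫⁻ x in Ico (0 : ℝ) 1, ENNReal.ofReal (φ t * ω t) *
        ENNReal.ofReal (c * (1 / tail ω (t * x))) := by
        refine setLIntegral_mono' measurableSet_Ico fun t ht => ?_
        rw [lintegral_const_mul' _ _ ENNReal.ofReal_ne_top]
        gcongr
        exact hinner t ht
    _ = ∫⁻ x in Ico (0 : ℝ) 1, ∫⁻ t in Ico (0 : ℝ) 1, ENNReal.ofReal (φ t * ω t) *
        ENNReal.ofReal (c * (1 / tail ω (t * x))) := (lintegral_lintegral_swap hmeas).symm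
    _ ≤ ∫⁻ x in Ico (0 : ℝ) 1, ‖hilbertOp ω (testFun a) x‖ₑ :=
        setLIntegral_mono' measurableSet_Ico hpoint
    _ ≤ 8 * B := hFR

end HilbertType

end

theorem theorem2 (ω : ℝ → ℝ) (hω : HilbertType.IsUpperDoubling ω) :
    List.TFAE
      [HilbertType.HilbertBoundedOnHardy ω,
       HilbertType.IsCarlesonForHardy 1 (HilbertType.radialMeasure ω),
       (⨆ a ∈ Set.Ico (0 : ℝ) 1,
          ENNReal.ofReal (1 / (1 - a)) *
            ∫⁻ t in Set.Ico a 1, ENNReal.ofReal (HilbertType.carlesonDensity ω t)) < ⊤] := by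
  obtain ⟨C, hC, hd⟩ := hω.doubling
  tfae_have 1 → 3 := fun h =>
    let ⟨_, hA⟩ := HilbertType.exists_tailBound_of_hilbertBoundedOnHardy hω.radialWeight hC hd h
    HilbertType.iSup_lt_top_of_tailBound hA
  tfae_have 3 → 1 := fun h =>
    let ⟨_, hA⟩ := HilbertType.exists_tailBound_of_iSup_lt_top h
    HilbertType.hilbertBoundedOnHardy_of_tailBound hω.radialWeight hC hd hA
  tfae_have 2 → 3 := fun h =>
    let ⟨_, hA⟩ := HilbertType.exists_tailBound_of_isCarlesonForHardy h
    HilbertType.iSup_lt_top_of_tailBound hA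
  tfae_have 3 → 2 := fun h =>
    let ⟨_, hA⟩ := HilbertType.exists_tailBound_of_iSup_lt_top h
    HilbertType.isCarlesonForHardy_of_tailBound hA
  tfae_finish
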